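/- Let $A$ and $C$ be unital $C^*$-algebras with states $\varphi$ and $\psi$, let $\otimes$ be the minimal $C^*$-tensor product, and let $j\colon A\to A\otimes C$ be a $*$-homomorphism (not necessarily unital) with $(\varphi\otimes\psi)\circ j=\varphi$. Put $j_0=\mathrm{id}_A$ and $j_{n+1}=(j_n\otimes \mathrm{id}_C)\circ j$; the $j_n\colon A\to A\otimes C^{\otimes n}$ are the random variables of a stationary noncommutative Markov chain. Let $(\mathfrak h,\Omega_\varphi)$ and $(\mathcal P,\Omega_\psi)$ be the GNS spaces of $(A,\varphi)$ and $(C,\psi)$, and let $v_1\colon\mathfrak h\to\mathfrak h\otimes\mathcal P$ be the isometry $a\,\Omega_\varphi\mapsto j(a)\,\Omega_\varphi\otimes\Omega_\psi$. Let $(\mathcal H,V,\mathfrak h)$ be the associated weak Markov process: $\mathfrak h$ is a closed subspace of the Hilbert space $\mathcal H$, $V\colon\mathcal H\otimes\mathcal P\to\mathcal H$ is an isometry with $V^*|_{\mathfrak h}=v_1$ (so $\mathfrak h$ is co-invariant), and $\mathcal H$ is the closed span of all $V_\alpha\mathfrak h$, where $V_p\xi=V(\xi\otimes p)$ for $p\in\mathcal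 P$ and $V_\alpha=V_{p_1}\cdots V_{p_n}$ for words $\alpha=(p_1,\dots,p_n)$, $n\ge 0$. (This is the minimal isometric dilation of $v_1^*$; it exists and is unique up to unitary equivalence.) Let $\mathfrak g=\mathbb C\,\Omega_\varphi\subset\mathfrak h$, let $\mathcal G$ be the closed span of all $V_\alpha\mathfrak g$, and $\mathfrak k=\mathfrak h\ominus\mathfrak g$. The subprocess on $\mathcal G$ with internal space $\mathfrak g$ and the quotient process with internal space $\mathfrak k$ form a short exact sequence of weak processes, called asymptotically complete if $\mathcal G=\mathcal H$. Let $Z(x)=P_{\mathfrak h}V(xP_{\mathfrak h}\otimes 1_{\mathcal P})V^*|_{\mathfrak h}$, $x\in\mathcal B(\mathfrak h)$, be the transition operator, and $P_{\mathfrak g}\in\mathcal B(\mathfrak h)$ the orthogonal projection onto $\mathfrak g$. The chain is called asymptotically complete in the sense of scattering theory (Kümmerer–Maassen) if for every $a\in A$ the limit $\lim_{n\to\infty}S^{-n}T^n(a)$ exists in the norm $\|\cdot\|_2$ of the product state and lies in the $\|\cdot\|_2$-closure of the noise $1_A\otimes C_{(-\infty,-1]}$. Here $T$ is the evolution of the chain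 and $S$ the free evolution (the shift of the noise), so that $S^{-n}T^n(a)$ is the element $j_n(a)\in A\otimes C^{\otimes n}$ with the $n$ factors $C$ placed at the times $-n,\dots,-1$ of $A\otimes C_{(-\infty,-1]}$. **Proposition.** The following are equivalent: 1. the short exact sequence of weak processes is asymptotically complete, $\mathcal G=\mathcal H$; 2. the stationary Markov chain is asymptotically complete in the sense of scattering theory; 3. $\lim_{n\to\infty}\|E_n(j_n(a))\|_2=\|a\|_2$ for all $a\in A$, where $E_n$ is the conditional expectation of $A\otimes C^{\otimes n}$ onto $1_A\otimes C^{\otimes n}$ given by $\varphi$ (on the GNS space, the orthogonal projection onto $\Omega_\varphi\otimes\mathcal P^{\otimes n}$); 4. $\lim_{n\to\infty}Z^n(P_{\mathfrak g})=1_{\mathfrak h}$ in the strong operator topology. Moreover, in this case $\mathfrak k$ is observable by the output space $\mathcal E^{\mathfrak g}=\overline{\mathrm{span}}(\mathfrak g,V(\mathfrak g\otimes\mathcal P))\ominus\mathfrak g$; that is, the map $\xi\mapsto(P_{\mathcal E^{\mathfrak g}}V_\alpha^*\xi)_\alpha$ is injective on $\mathfrak k$. -/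

import Mathlib

open scoped TensorProduct InnerProductSpace ComplexOrder
open Filter Topology

universe u

namespace WeakMarkov

noncomputable section

/-! ### Hilbert space tensor products -/

section HilbertTensor

variable {E F G H : Type*}
  [NormedAddCommGroup E] [InnerProductSpace ℂ E] [NormedAddCommGroup F] [InnerProductSpace ℂ F]
  [NormedAddCommGroup G] [InnerProductSpace ℂ G] [NormedAddCommGroup H] [InnerProductSpace ℂ H]

/-- The Hilbert space tensor product `E ⊗ F`. -/
def HTensor (E F : Type*) [NormedAddCommGroup E] [InnerProductSpace ℂ E]
    [NormedAddCommGroup F] [InnerProductSpace ℂ F] : Type _ :=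
  UniformSpace.Completion (E ⊗[ℂ] F)

instance : NormedAddCommGroup (HTensor E F) :=
  inferInstanceAs (NormedAddCommGroup (UniformSpace.Completion (E ⊗[ℂ] F)))

instance : InnerProductSpace ℂ (HTensor E F) :=
  inferInstanceAs (InnerProductSpace ℂ (UniformSpace.Completion (E ⊗[ℂ] F)))

instance : CompleteSpace (HTensor E F) :=
  inferInstanceAs (CompleteSpace (UniformSpace.Completion (E ⊗[ℂ] F)))

/-- The inclusion of the algebraic tensor product. -/
def HTensor.of : E ⊗[ℂ] F →ₗᵢ[ℂ] HTensor E F :=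
  UniformSpace.Completion.toComplₗᵢ (𝕜 := ℂ) (E := E ⊗[ℂ] F)

theorem HTensor.denseRange_of : DenseRange (HTensor.of : E ⊗[ℂ] F → HTensor E F) :=
  UniformSpace.Completion.denseRange_coe

/-- The elementary tensor `x ⊗ y`. -/
def htmul (x : E) (y : F) : HTensor E F := HTensor.of (x ⊗ₜ[ℂ] y)

theorem add_htmul (x x' : E) (y : F) : htmul (x + x') y = htmul x y + htmul x' y := by
  simp [htmul, TensorProduct.add_tmul]

theorem htmul_add (x : E) (y y' : F) : htmul x (y + y') = htmul x y + htmul x y' := by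
  simp [htmul, TensorProduct.tmul_add]

theorem smul_htmul (r : ℂ) (x : E) (y : F) : htmul (r • x) y = r • htmul x y := by
  rw [htmul, htmul, ← map_smul, TensorProduct.smul_tmul']

theorem htmul_smul (r : ℂ) (x : E) (y : F) : htmul x (r • y) = r • htmul x y := by
  rw [htmul, htmul, ← map_smul, TensorProduct.tmul_smul]

theorem inner_htmul (x x' : E) (y y' : F) :
    ⟪htmul x y, htmul x' y'⟫_ℂ = ⟪x, x'⟫_ℂ * ⟪y, y'⟫_ℂ := by
  simp [htmul]

theorem norm_htmul (x : E) (y : F) : ‖htmul x y‖ = ‖x‖ * ‖y‖ := by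
  simp [htmul]

theorem HTensor.induction {p : HTensor E F → Prop} (hp : IsClosed {z | p z}) (h0 : p 0)
    (htm : ∀ x y, p (htmul x y)) (hadd : ∀ z w, p z → p w → p (z + w)) (z : HTensor E F) : p z := by
  refine HTensor.denseRange_of.induction_on z hp fun z => ?_
  induction z using TensorProduct.induction_on with
  | zero => rwa [map_zero]
  | tmul x y => exact htm x y
  | add a b ha hb => rw [map_add]; exact hadd _ _ ha hb

/-- Two bounded operators on `E ⊗ F` that agree on elementary tensors are equal. -/
theorem hext {X : Type*} [NormedAddCommGroup X] [NormedSpace ℂ X] {S T : HTensor E F →L[ℂ] X}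
    (h : ∀ x y, S (htmul x y) = T (htmul x y)) : S = T := by
  ext z
  induction z using HTensor.induction with
  | hp => exact isClosed_eq S.continuous T.continuous
  | h0 => rw [map_zero, map_zero]
  | htm x y => exact h x y
  | hadd z w hz hw => rw [map_add, map_add, hz, hw]

/-- The bounded operator `f ⊗ g`. -/
def hmap (f : E →L[ℂ] G) (g : F →L[ℂ] H) : HTensor E F →L[ℂ] HTensor G H :=
  (TensorProduct.mapL f g).completion

theorem hmap_of (f : E →L[ℂ] G) (g : F →L[ℂ] H) (z : E ⊗[ℂ] F) :
    hmap f g (HTensor.of z) = HTensor.of (TensorProduct.mapL f g z) :=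
  ContinuousLinearMap.completion_apply_coe (TensorProduct.mapL f g) z

theorem hmap_htmul (f : E →L[ℂ] G) (g : F →L[ℂ] H) (x : E) (y : F) :
    hmap f g (htmul x y) = htmul (f x) (g y) := by
  simp [htmul, hmap_of]

theorem hmap_mul (f f' : E →L[ℂ] E) (g g' : F →L[ℂ] F) :
    hmap (f * f') (g * g') = hmap f g * hmap f' g' :=
  hext fun x y => by
    change _ = hmap f g (hmap f' g' (htmul x y))
    rw [hmap_htmul, hmap_htmul, hmap_htmul]
    rfl

theorem hmap_star [CompleteSpace E] [CompleteSpace F] (f : E →L[ℂ] E) (g : F →L[ℂ] F) :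
    hmap (star f) (star g) = star (hmap f g) := by
  rw [ContinuousLinearMap.star_eq_adjoint (hmap f g), ContinuousLinearMap.eq_adjoint_iff]
  intro z w
  induction z using HTensor.induction with
  | hp => apply isClosed_eq <;> fun_prop
  | h0 => simp
  | hadd a b ha hb => rw [map_add, inner_add_left, inner_add_left, ha, hb]
  | htm x y =>
    induction w using HTensor.induction with
    | hp => apply isClosed_eq <;> fun_prop
    | h0 => simp
    | hadd a b ha hb => rw [map_add, inner_add_right, inner_add_right, ha, hb]
    | htm x' y' =>
      simp only [hmap_htmul, inner_htmul, ContinuousLinearMap.star_eq_adjoint,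
        ContinuousLinearMap.adjoint_inner_left]

theorem norm_hmap_le (f : E →L[ℂ] G) (g : F →L[ℂ] H) : ‖hmap f g‖ ≤ ‖f‖ * ‖g‖ := by
  refine ContinuousLinearMap.opNorm_le_bound _ (by positivity) fun z => ?_
  refine HTensor.denseRange_of.induction_on z (isClosed_le (by fun_prop) (by fun_prop)) fun z => ?_
  rw [hmap_of, LinearIsometry.norm_map, LinearIsometry.norm_map]
  exact (ContinuousLinearMap.le_opNorm _ _).trans
      (mul_le_mul_of_nonneg_right (TensorProduct.norm_mapL_le f g) (norm_nonneg _))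

/-- The linear isometry on `E ⊗ F` determined by a bilinear map `B` with
`⟪B x y, B x' y'⟫ = ⟪x, x'⟫ ⟪y, y'⟫`. -/
def hlift [CompleteSpace G] (B : E →ₗ[ℂ] F →ₗ[ℂ] G)
    (hB : ∀ x x' y y', ⟪B x y, B x' y'⟫_ℂ = ⟪x, x'⟫_ℂ * ⟪y, y'⟫_ℂ) : HTensor E F →ₗᵢ[ℂ] G :=
  let f : E ⊗[ℂ] F →ₗᵢ[ℂ] G := (TensorProduct.lift B).isometryOfInner fun z w => by
    induction z using TensorProduct.induction_on with
    | zero => rw [map_zero, inner_zero_left, inner_zero_left]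
    | add a b ha hb => rw [map_add, inner_add_left, inner_add_left, ha, hb]
    | tmul x y =>
      induction w using TensorProduct.induction_on with
      | zero => rw [map_zero, inner_zero_right, inner_zero_right]
      | add a b ha hb => rw [map_add, inner_add_right, inner_add_right, ha, hb]
      | tmul x' y' => simp [hB]
  let g : HTensor E F →L[ℂ] G := f.toContinuousLinearMap.fromCompletion
  { g with
    norm_map' := fun z => by
      change ‖g z‖ = ‖z‖
      refine HTensor.denseRange_of.induction_on z (isClosed_eq (by fun_prop) (by fun_prop))
        fun z => ?_
      have : g (HTensor.of z) = f z :=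
        ContinuousLinearMap.fromCompletion_apply_coe f.toContinuousLinearMap z
      rw [this, LinearIsometry.norm_map, LinearIsometry.norm_map] }

theorem hlift_htmul [CompleteSpace G] (B : E →ₗ[ℂ] F →ₗ[ℂ] G)
    (hB : ∀ x x' y y', ⟪B x y, B x' y'⟫_ℂ = ⟪x, x'⟫_ℂ * ⟪y, y'⟫_ℂ) (x : E) (y : F) :
    hlift B hB (htmul x y) = B x y := by
  refine (ContinuousLinearMap.fromCompletion_apply_coe _ _).trans ?_
  simp

/-- The isometry `f ⊗ g` for isometries `f` and `g`. -/
def hmapIsometry (f : E →ₗᵢ[ℂ] G) (g : F →ₗᵢ[ℂ] H) : HTensor E F →ₗᵢ[ℂ] HTensor G H :=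
  { hmap f.toContinuousLinearMap g.toContinuousLinearMap with
    norm_map' := fun z => by
      change ‖hmap f.toContinuousLinearMap g.toContinuousLinearMap z‖ = ‖z‖
      refine HTensor.denseRange_of.induction_on z (isClosed_eq (by fun_prop) (by fun_prop))
        fun z => ?_
      rw [hmap_of, LinearIsometry.norm_map, LinearIsometry.norm_map,
        ← TensorProduct.toContinuousLinearMap_mapIsometry]
      exact (TensorProduct.mapIsometry f g).norm_map z }

theorem hmapIsometry_htmul (f : E →ₗᵢ[ℂ] G) (g : F →ₗᵢ[ℂ] H) (x : E) (y : F) :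
    hmapIsometry f g (htmul x y) = htmul (f x) (g y) :=
  hmap_htmul _ _ x y

/-- The operator `x ↦ x ⊗ p`. -/
def tmulRight (E : Type*) [NormedAddCommGroup E] [InnerProductSpace ℂ E] (p : F) :
    E →L[ℂ] HTensor E F :=
  LinearMap.mkContinuous
    { toFun := fun x => htmul x p
      map_add' := fun x y => add_htmul x y p
      map_smul' := fun r x => smul_htmul r x p } ‖p‖
    fun x => by
      change ‖htmul x p‖ ≤ _
      rw [norm_htmul, mul_comm]

variable (F) in
/-- The closed subspace `L ⊗ F` of `E ⊗ F`. -/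
def tensorSpan (L : Submodule ℂ E) : Submodule ℂ (HTensor E F) :=
  (⨆ p : F, L.map (tmulRight E p).toLinearMap).topologicalClosure

variable (F) in
theorem isClosed_tensorSpan (L : Submodule ℂ E) :
    IsClosed (tensorSpan F L : Set (HTensor E F)) :=
  Submodule.isClosed_topologicalClosure _

theorem htmul_mem_tensorSpan {L : Submodule ℂ E} {x : E} (hx : x ∈ L) (p : F) :
    htmul x p ∈ tensorSpan F L :=
  Submodule.le_topologicalClosure _ (Submodule.mem_iSup_of_mem p ⟨x, hx, rfl⟩)

theorem tensorSpan_top : tensorSpan F (⊤ : Submodule ℂ E) = ⊤ := by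
  rw [eq_top_iff]
  rintro z -
  induction z using HTensor.induction with
  | hp => exact isClosed_tensorSpan F ⊤
  | h0 => exact zero_mem _
  | htm x y => exact htmul_mem_tensorSpan Submodule.mem_top y
  | hadd z w hz hw => exact add_mem hz hw

theorem tmulRight_adjoint_htmul [CompleteSpace E] (p : F) (x : E) (q : F) :
    (tmulRight E p).adjoint (htmul x q) = ⟪p, q⟫_ℂ • x := by
  refine ext_inner_left ℂ fun y => ?_
  rw [ContinuousLinearMap.adjoint_inner_right, inner_smul_right]
  change ⟪htmul y p, htmul x q⟫_ℂ = _
  rw [inner_htmul, mul_comm]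

theorem tmulRight_adjoint_hmapIsometry [CompleteSpace E] [CompleteSpace G] (f : E →ₗᵢ[ℂ] G) (p : F)
    (z : HTensor E F) : (tmulRight G p).adjoint (hmapIsometry f LinearIsometry.id z) =
      f ((tmulRight E p).adjoint z) := by
  induction z using HTensor.induction with
  | hp => exact isClosed_eq (by fun_prop) (by fun_prop)
  | h0 => simp
  | htm x y =>
    rw [hmapIsometry_htmul, tmulRight_adjoint_htmul, tmulRight_adjoint_htmul, map_smul]
    rfl
  | hadd z w hz hw => rw [map_add, map_add, map_add, map_add, hz, hw]

end HilbertTensor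

/-! ### The minimal (spatial) tensor product of C*-algebras -/

section CStarTensor

variable {A B C : Type u} [CStarAlgebra A] [CStarAlgebra B] [CStarAlgebra C]

/-- The algebraic tensor product of two C*-algebras, to be normed by the spatial norm. -/
def AlgTensor (A C : Type u) [CStarAlgebra A] [CStarAlgebra C] : Type u := A ⊗[ℂ] C

instance : Ring (AlgTensor A C) := inferInstanceAs (Ring (A ⊗[ℂ] C))
instance : Algebra ℂ (AlgTensor A C) := inferInstanceAs (Algebra ℂ (A ⊗[ℂ] C))
instance : StarRing (AlgTensor A C) := inferInstanceAs (StarRing (A ⊗[ℂ] C))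
instance : StarModule ℂ (AlgTensor A C) := inferInstanceAs (StarModule ℂ (A ⊗[ℂ] C))

/-- The elementary tensor `a ⊗ c` in the algebraic tensor product. -/
def atmul (a : A) (c : C) : AlgTensor A C := a ⊗ₜ[ℂ] c

theorem AlgTensor.induction {p : AlgTensor A C → Prop} (h0 : p 0) (htm : ∀ a c, p (atmul a c))
    (hadd : ∀ z w, p z → p w → p (z + w)) (z : AlgTensor A C) : p z :=
  TensorProduct.induction_on (motive := p) z h0 htm hadd

theorem atmul_mul (a a' : A) (c c' : C) :
    atmul a c * atmul a' c' = atmul (a * a') (c * c') :=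
  Algebra.TensorProduct.tmul_mul_tmul (R := ℂ) a a' c c'

theorem atmul_star (a : A) (c : C) : star (atmul a c) = atmul (star a) (star c) := rfl

theorem one_eq_atmul : (1 : AlgTensor A C) = atmul 1 1 := rfl

/-- The linear map on the algebraic tensor product determined by a bilinear map. -/
def alift {X : Type*} [AddCommGroup X] [Module ℂ X] (f : A →ₗ[ℂ] C →ₗ[ℂ] X) :
    AlgTensor A C →ₗ[ℂ] X :=
  (TensorProduct.lift f : A ⊗[ℂ] C →ₗ[ℂ] X)

theorem alift_atmul {X : Type*} [AddCommGroup X] [Module ℂ X] (f : A →ₗ[ℂ] C →ₗ[ℂ] X)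
    (a : A) (c : C) : alift f (atmul a c) = f a c := rfl

/-- The *-homomorphism on the algebraic tensor product determined by a bilinear map that is
multiplicative and *-preserving on elementary tensors. -/
def astarLift {X : Type*} [NonUnitalRing X] [Module ℂ X] [StarRing X] (f : A →ₗ[ℂ] C →ₗ[ℂ] X)
    (hmul : ∀ a a' c c', f (a * a') (c * c') = f a c * f a' c')
    (hstar : ∀ a c, f (star a) (star c) = star (f a c)) : AlgTensor A C →⋆ₙₐ[ℂ] X :=
  { alift f with
    map_zero' := (alift f).map_zero
    map_mul' := fun z w => by
      change alift f (z * w) = alift f z * alift f w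
      induction z using AlgTensor.induction with
      | h0 => rw [zero_mul, map_zero, zero_mul]
      | hadd a b ha hb => rw [add_mul, map_add, map_add, ha, hb, add_mul]
      | htm x y =>
        induction w using AlgTensor.induction with
        | h0 => rw [mul_zero, map_zero, mul_zero]
        | hadd a b ha hb => rw [mul_add, map_add, map_add, ha, hb, mul_add]
        | htm x' y' => rw [atmul_mul, alift_atmul, alift_atmul, alift_atmul, hmul]
    map_star' := fun z => by
      change alift f (star z) = star (alift f z)
      induction z using AlgTensor.induction with
      | h0 => rw [star_zero, map_zero, star_zero]
      | hadd a b ha hb => rw [star_add, map_add, map_add, ha, hb, star_add]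
      | htm x y => rw [atmul_star, alift_atmul, alift_atmul, hstar] }

theorem astarLift_atmul {X : Type*} [NonUnitalRing X] [Module ℂ X] [StarRing X]
    (f : A →ₗ[ℂ] C →ₗ[ℂ] X)
    (hmul : ∀ a a' c c', f (a * a') (c * c') = f a c * f a' c')
    (hstar : ∀ a c, f (star a) (star c) = star (f a c)) (a : A) (c : C) :
    astarLift f hmul hstar (atmul a c) = f a c := rfl

/-- The representation `π ⊗ ρ` of the algebraic tensor product on the Hilbert tensor product. -/
def algRep {H K : Type*} [NormedAddCommGroup H] [InnerProductSpace ℂ H] [CompleteSpace H]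
    [NormedAddCommGroup K] [InnerProductSpace ℂ K] [CompleteSpace K]
    (π : A →⋆ₙₐ[ℂ] (H →L[ℂ] H)) (ρ : C →⋆ₙₐ[ℂ] (K →L[ℂ] K)) :
    AlgTensor A C →⋆ₙₐ[ℂ] (HTensor H K →L[ℂ] HTensor H K) :=
  astarLift (LinearMap.mk₂ ℂ (fun a c => hmap (π a) (ρ c))
      (fun a a' c => hext fun x y => by
        simp only [add_apply, hmap_htmul, map_add, add_htmul])
      (fun r a c => hext fun x y => by
        simp only [smul_apply, hmap_htmul, map_smul, smul_htmul])
      (fun a c c' => hext fun x y => by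
        simp only [add_apply, hmap_htmul, map_add, htmul_add])
      (fun r a c => hext fun x y => by
        simp only [smul_apply, hmap_htmul, map_smul, htmul_smul]))
    (fun a a' c c' => by simp only [LinearMap.mk₂_apply, map_mul, hmap_mul])
    (fun a c => by simp only [LinearMap.mk₂_apply, map_star, hmap_star])

theorem algRep_atmul {H K : Type*} [NormedAddCommGroup H] [InnerProductSpace ℂ H] [CompleteSpace H]
    [NormedAddCommGroup K] [InnerProductSpace ℂ K] [CompleteSpace K]
    (π : A →⋆ₙₐ[ℂ] (H →L[ℂ] H)) (ρ : C →⋆ₙₐ[ℂ] (K →L[ℂ] K)) (a : A) (c : C) :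
    algRep π ρ (atmul a c) = hmap (π a) (ρ c) := rfl

/-- A pair of representations of `A` and `C` on Hilbert spaces. -/
structure RepPair (A C : Type u) [CStarAlgebra A] [CStarAlgebra C] : Type (u + 1) where
  H : Type u
  K : Type u
  [normH : NormedAddCommGroup H]
  [innerH : InnerProductSpace ℂ H]
  [completeH : CompleteSpace H]
  [normK : NormedAddCommGroup K]
  [innerK : InnerProductSpace ℂ K]
  [completeK : CompleteSpace K]
  π : A →⋆ₙₐ[ℂ] (H →L[ℂ] H)
  ρ : C →⋆ₙₐ[ℂ] (K →L[ℂ] K)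

attribute [instance] RepPair.normH RepPair.innerH RepPair.completeH
  RepPair.normK RepPair.innerK RepPair.completeK

/-- The representation `π ⊗ ρ` belonging to a pair of representations. -/
def RepPair.rep (R : RepPair A C) :
    AlgTensor A C →⋆ₙₐ[ℂ] (HTensor R.H R.K →L[ℂ] HTensor R.H R.K) := algRep R.π R.ρ

/-- The spatial norm `‖x‖ = sup ‖(π ⊗ ρ)(x)‖` over all representations `π` of `A` and `ρ` of `C`. -/
def spatialNorm (x : AlgTensor A C) : ℝ := ⨆ R : RepPair A C, ‖R.rep x‖

instance : Nonempty (RepPair A C) := ⟨{ H := PUnit, K := PUnit, π := 0, ρ := 0 }⟩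

theorem bddAbove_rep (x : AlgTensor A C) :
    BddAbove (Set.range fun R : RepPair A C => ‖R.rep x‖) := by
  suffices h : ∃ M : ℝ, ∀ R : RepPair A C, ‖R.rep x‖ ≤ M by
    obtain ⟨M, hM⟩ := h
    exact ⟨M, by rintro _ ⟨R, rfl⟩; exact hM R⟩
  induction x using AlgTensor.induction with
  | h0 => exact ⟨0, fun R => by rw [map_zero, norm_zero]⟩
  | htm a c =>
    refine ⟨‖a‖ * ‖c‖, fun R => (norm_hmap_le _ _).trans ?_⟩
    gcongr
    · exact NonUnitalStarAlgHom.norm_apply_le R.π a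
    · exact NonUnitalStarAlgHom.norm_apply_le R.ρ c
  | hadd x y hx hy =>
    obtain ⟨M, hM⟩ := hx
    obtain ⟨N, hN⟩ := hy
    exact ⟨M + N, fun R => by
      rw [map_add]; exact (norm_add_le _ _).trans (add_le_add (hM R) (hN R))⟩

theorem norm_rep_le (R : RepPair A C) (x : AlgTensor A C) : ‖R.rep x‖ ≤ spatialNorm x :=
  le_ciSup (bddAbove_rep x) R

theorem spatialNorm_le {x : AlgTensor A C} {M : ℝ} (h : ∀ R : RepPair A C, ‖R.rep x‖ ≤ M) :
    spatialNorm x ≤ M := ciSup_le h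

theorem spatialNorm_nonneg (x : AlgTensor A C) : 0 ≤ spatialNorm x :=
  (norm_nonneg _).trans (norm_rep_le (Classical.arbitrary _) x)

/-- The spatial norm as a ring seminorm. -/
def spatialSeminorm (A C : Type u) [CStarAlgebra A] [CStarAlgebra C] :
    RingSeminorm (AlgTensor A C) where
  toFun := spatialNorm
  map_zero' := le_antisymm (spatialNorm_le fun R => by rw [map_zero, norm_zero])
    (spatialNorm_nonneg _)
  add_le' x y := spatialNorm_le fun R => by
    rw [map_add]
    exact (norm_add_le _ _).trans (add_le_add (norm_rep_le R x) (norm_rep_le R y))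
  mul_le' x y := spatialNorm_le fun R => by
    rw [map_mul]
    exact (norm_mul_le _ _).trans (mul_le_mul (norm_rep_le R x) (norm_rep_le R y)
      (norm_nonneg _) (spatialNorm_nonneg _))
  neg' x := by
    have h : ∀ R : RepPair A C, ‖R.rep (-x)‖ = ‖R.rep x‖ := fun R => by rw [map_neg, norm_neg]
    exact iSup_congr h

instance : SeminormedRing (AlgTensor A C) := (spatialSeminorm A C).toSeminormedRing

theorem algTensor_norm_def (x : AlgTensor A C) : ‖x‖ = spatialNorm x := rfl

theorem algTensor_norm_star (x : AlgTensor A C) : ‖star x‖ = ‖x‖ := by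
  rw [algTensor_norm_def, algTensor_norm_def]
  exact iSup_congr fun R => by
    rw [map_star, norm_star]

theorem algTensor_norm_mul_self_le (x : AlgTensor A C) : ‖x‖ * ‖x‖ ≤ ‖star x * x‖ := by
  have h : ‖x‖ ≤ Real.sqrt ‖star x * x‖ := spatialNorm_le fun R => by
    apply Real.le_sqrt_of_sq_le
    rw [sq, ← CStarRing.norm_star_mul_self, ← map_star, ← map_mul]
    exact norm_rep_le R (star x * x)
  calc ‖x‖ * ‖x‖ ≤ Real.sqrt ‖star x * x‖ * Real.sqrt ‖star x * x‖ := by gcongr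
    _ = ‖star x * x‖ := Real.mul_self_sqrt (norm_nonneg _)

theorem algTensor_norm_smul_le (r : ℂ) (x : AlgTensor A C) : ‖r • x‖ ≤ ‖r‖ * ‖x‖ :=
  spatialNorm_le fun R => by
    rw [map_smul, norm_smul]
    exact mul_le_mul_of_nonneg_left (norm_rep_le R x) (norm_nonneg r)

instance : NormedAlgebra ℂ (AlgTensor A C) where
  norm_smul_le := algTensor_norm_smul_le

/-- The minimal (spatial) C*-tensor product: the completion of the algebraic tensor product in the
spatial norm. -/
def CTensor (A C : Type u) [CStarAlgebra A] [CStarAlgebra C] : Type u :=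
  UniformSpace.Completion (AlgTensor A C)

instance : NormedRing (CTensor A C) :=
  inferInstanceAs (NormedRing (UniformSpace.Completion (AlgTensor A C)))

instance : CompleteSpace (CTensor A C) :=
  inferInstanceAs (CompleteSpace (UniformSpace.Completion (AlgTensor A C)))

instance : Algebra ℂ (CTensor A C) :=
  inferInstanceAs (Algebra ℂ (UniformSpace.Completion (AlgTensor A C)))

/-- The inclusion of the algebraic tensor product. -/
def CTensor.of (x : AlgTensor A C) : CTensor A C := (x : UniformSpace.Completion (AlgTensor A C))

theorem CTensor.denseRange_of : DenseRange (CTensor.of : AlgTensor A C → CTensor A C) :=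
  UniformSpace.Completion.denseRange_coe

theorem CTensor.norm_of (x : AlgTensor A C) : ‖CTensor.of x‖ = ‖x‖ :=
  UniformSpace.Completion.norm_coe x

theorem CTensor.continuous_of : Continuous (CTensor.of : AlgTensor A C → CTensor A C) :=
  UniformSpace.Completion.continuous_coe _

theorem CTensor.of_add (x y : AlgTensor A C) : CTensor.of (x + y) = CTensor.of x + CTensor.of y :=
  UniformSpace.Completion.coe_add x y

theorem CTensor.of_mul (x y : AlgTensor A C) : CTensor.of (x * y) = CTensor.of x * CTensor.of y :=
  UniformSpace.Completion.coe_mul x y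

theorem CTensor.of_zero : CTensor.of (0 : AlgTensor A C) = 0 :=
  UniformSpace.Completion.coe_zero

theorem CTensor.of_one : CTensor.of (1 : AlgTensor A C) = 1 :=
  UniformSpace.Completion.coe_one _

theorem CTensor.of_smul (r : ℂ) (x : AlgTensor A C) : CTensor.of (r • x) = r • CTensor.of x :=
  UniformSpace.Completion.coe_smul r x

theorem CTensor.induction {p : CTensor A C → Prop} (hp : IsClosed {x | p x})
    (h : ∀ x, p (CTensor.of x)) (x : CTensor A C) : p x :=
  CTensor.denseRange_of.induction_on x hp h

theorem CTensor.continuous_smul (r : ℂ) : Continuous fun x : CTensor A C => r • x := by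
  have h : (fun x : CTensor A C => r • x) = fun x => algebraMap ℂ (CTensor A C) r * x :=
    funext fun x => Algebra.smul_def r x
  rw [h]
  exact continuous_const.mul continuous_id

instance : NormedAlgebra ℂ (CTensor A C) where
  norm_smul_le r x := by
    induction x using CTensor.induction with
    | hp => exact isClosed_le (CTensor.continuous_smul r).norm (continuous_const.mul continuous_norm)
    | h x =>
      rw [← CTensor.of_smul, CTensor.norm_of, CTensor.norm_of]
      exact algTensor_norm_smul_le r x

/-- The continuous extension to the completion of a bounded map into a complete space. -/
def CTensor.extend {X : Type*} [UniformSpace X] (f : AlgTensor A C → X) : CTensor A C → X :=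
  UniformSpace.Completion.extension f

theorem CTensor.continuous_extend {X : Type*} [UniformSpace X] [CompleteSpace X]
    (f : AlgTensor A C → X) : Continuous (CTensor.extend f) :=
  UniformSpace.Completion.continuous_extension

theorem CTensor.extend_of {X : Type*} [UniformSpace X] [CompleteSpace X] [T0Space X]
    {f : AlgTensor A C → X} (hf : UniformContinuous f) (x : AlgTensor A C) :
    CTensor.extend f (CTensor.of x) = f x :=
  UniformSpace.Completion.extension_coe hf x

instance : Star (CTensor A C) := ⟨CTensor.extend fun x => CTensor.of (star x)⟩

theorem CTensor.continuous_star : Continuous (star : CTensor A C → CTensor A C) :=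
  CTensor.continuous_extend _

theorem CTensor.star_of (x : AlgTensor A C) : star (CTensor.of x) = CTensor.of (star x) := by
  refine CTensor.extend_of (AddMonoidHomClass.uniformContinuous_of_bound
    ({ toFun := fun x => CTensor.of (star x)
       map_zero' := by rw [star_zero, CTensor.of_zero]
       map_add' := fun x y => by rw [star_add, CTensor.of_add] } : AlgTensor A C →+ CTensor A C)
    1 fun x => ?_) x
  change ‖CTensor.of (star x)‖ ≤ _
  rw [CTensor.norm_of, algTensor_norm_star, one_mul]

instance : StarRing (CTensor A C) where
  star_involutive x := by
    have := CTensor.continuous_star (A := A) (C := C)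
    refine CTensor.denseRange_of.induction_on x (isClosed_eq (by fun_prop) (by fun_prop))
      fun x => ?_
    rw [CTensor.star_of, CTensor.star_of, star_star]
  star_mul x y := by
    have := CTensor.continuous_star (A := A) (C := C)
    refine CTensor.denseRange_of.induction_on₂ (isClosed_eq (by fun_prop) (by fun_prop))
      (fun x y => ?_) x y
    rw [← CTensor.of_mul, CTensor.star_of, CTensor.star_of, CTensor.star_of, star_mul,
      CTensor.of_mul]
  star_add x y := by
    have := CTensor.continuous_star (A := A) (C := C)
    refine CTensor.denseRange_of.induction_on₂ (isClosed_eq (by fun_prop) (by fun_prop))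
      (fun x y => ?_) x y
    rw [← CTensor.of_add, CTensor.star_of, CTensor.star_of, CTensor.star_of, star_add,
      CTensor.of_add]

instance : CStarAlgebra (CTensor A C) where
  norm_mul_self_le x := by
    have := CTensor.continuous_star (A := A) (C := C)
    refine CTensor.denseRange_of.induction_on x (isClosed_le (by fun_prop) (by fun_prop))
      fun x => ?_
    rw [CTensor.star_of, ← CTensor.of_mul, CTensor.norm_of, CTensor.norm_of]
    exact algTensor_norm_mul_self_le x
  star_smul r x := by
    have := CTensor.continuous_star (A := A) (C := C)
    induction x using CTensor.induction with
    | hp =>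
      exact isClosed_eq (this.comp (CTensor.continuous_smul r))
        ((CTensor.continuous_smul (star r)).comp this)
    | h x =>
      rw [← CTensor.of_smul, CTensor.star_of, CTensor.star_of, star_smul, CTensor.of_smul]

/-- The elementary tensor `a ⊗ c`. -/
def ctmul (a : A) (c : C) : CTensor A C := CTensor.of (atmul a c)

/-- The continuous extension of a contractive *-homomorphism on the algebraic tensor product. -/
def CTensor.starLift {X : Type*} [NonUnitalCStarAlgebra X] (f : AlgTensor A C →⋆ₙₐ[ℂ] X)
    (hf : ∀ x, ‖f x‖ ≤ ‖x‖) : CTensor A C →⋆ₙₐ[ℂ] X :=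
  have hu : UniformContinuous f := AddMonoidHomClass.uniformContinuous_of_bound f 1 (by simpa)
  have hc := CTensor.continuous_extend f
  { toFun := CTensor.extend f
    map_smul' := fun r x => by
      induction x using CTensor.induction with
      | hp =>
        exact isClosed_eq (hc.comp (CTensor.continuous_smul r)) (hc.const_smul r)
      | h x =>
      change CTensor.extend f (r • _) = r • _
      rw [← CTensor.of_smul, CTensor.extend_of hu, CTensor.extend_of hu, map_smul]
    map_zero' := by rw [← CTensor.of_zero, CTensor.extend_of hu, map_zero]
    map_add' := fun x y => by
      refine CTensor.denseRange_of.induction_on₂ (isClosed_eq (by fun_prop) (by fun_prop))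
        (fun x y => ?_) x y
      rw [← CTensor.of_add, CTensor.extend_of hu, CTensor.extend_of hu, CTensor.extend_of hu,
        map_add]
    map_mul' := fun x y => by
      refine CTensor.denseRange_of.induction_on₂ (isClosed_eq (by fun_prop) (by fun_prop))
        (fun x y => ?_) x y
      rw [← CTensor.of_mul, CTensor.extend_of hu, CTensor.extend_of hu, CTensor.extend_of hu,
        map_mul]
    map_star' := fun x => by
      have := CTensor.continuous_star (A := A) (C := C)
      refine CTensor.denseRange_of.induction_on x (isClosed_eq (by fun_prop) (by fun_prop))
        fun x => ?_
      rw [CTensor.star_of, CTensor.extend_of hu, CTensor.extend_of hu, map_star] }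

theorem CTensor.starLift_of {X : Type*} [NonUnitalCStarAlgebra X] (f : AlgTensor A C →⋆ₙₐ[ℂ] X)
    (hf : ∀ x, ‖f x‖ ≤ ‖x‖) (x : AlgTensor A C) : CTensor.starLift f hf (CTensor.of x) = f x :=
  CTensor.extend_of (AddMonoidHomClass.uniformContinuous_of_bound f 1 (by simpa)) x

/-- The representation `π ⊗ ρ` of the spatial tensor product. -/
def tensorRep {H K : Type u} [NormedAddCommGroup H] [InnerProductSpace ℂ H] [CompleteSpace H]
    [NormedAddCommGroup K] [InnerProductSpace ℂ K] [CompleteSpace K]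
    (π : A →⋆ₙₐ[ℂ] (H →L[ℂ] H)) (ρ : C →⋆ₙₐ[ℂ] (K →L[ℂ] K)) :
    CTensor A C →⋆ₙₐ[ℂ] (HTensor H K →L[ℂ] HTensor H K) :=
  CTensor.starLift (algRep π ρ) fun x => norm_rep_le ⟨H, K, π, ρ⟩ x

theorem tensorRep_ctmul {H K : Type u}
    [NormedAddCommGroup H] [InnerProductSpace ℂ H] [CompleteSpace H]
    [NormedAddCommGroup K] [InnerProductSpace ℂ K] [CompleteSpace K]
    (π : A →⋆ₙₐ[ℂ] (H →L[ℂ] H)) (ρ : C →⋆ₙₐ[ℂ] (K →L[ℂ] K)) (a : A) (c : C) :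
    tensorRep π ρ (ctmul a c) = hmap (π a) (ρ c) :=
  CTensor.starLift_of _ _ _

theorem add_ctmul (a a' : A) (c : C) : ctmul (a + a') c = ctmul a c + ctmul a' c := by
  rw [ctmul, ctmul, ctmul, ← CTensor.of_add]
  exact congrArg CTensor.of (TensorProduct.add_tmul (R := ℂ) a a' c)

theorem ctmul_add (a : A) (c c' : C) : ctmul a (c + c') = ctmul a c + ctmul a c' := by
  rw [ctmul, ctmul, ctmul, ← CTensor.of_add]
  exact congrArg CTensor.of (TensorProduct.tmul_add (R := ℂ) a c c')

theorem smul_ctmul (r : ℂ) (a : A) (c : C) : ctmul (r • a) c = r • ctmul a c := by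
  rw [ctmul, ctmul, ← CTensor.of_smul]
  exact congrArg CTensor.of (TensorProduct.smul_tmul' (R := ℂ) r a c).symm

theorem ctmul_smul (r : ℂ) (a : A) (c : C) : ctmul a (r • c) = r • ctmul a c := by
  rw [ctmul, ctmul, ← CTensor.of_smul]
  exact congrArg CTensor.of (TensorProduct.tmul_smul (R := ℂ) r a c)

theorem ctmul_mul (a a' : A) (c c' : C) : ctmul a c * ctmul a' c' = ctmul (a * a') (c * c') := by
  rw [ctmul, ctmul, ctmul, ← CTensor.of_mul, atmul_mul]

theorem ctmul_star (a : A) (c : C) : star (ctmul a c) = ctmul (star a) (star c) := by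
  rw [ctmul, ctmul, CTensor.star_of, atmul_star]

/-- The *-homomorphism `f ⊗ id` of algebraic tensor products, followed by the inclusion into the
spatial tensor product. -/
def algMapId (f : A →⋆ₙₐ[ℂ] B) : AlgTensor A C →⋆ₙₐ[ℂ] CTensor B C :=
  astarLift (LinearMap.mk₂ ℂ (fun a c => ctmul (f a) c)
      (fun a a' c => by rw [map_add, add_ctmul])
      (fun r a c => by rw [map_smul, smul_ctmul])
      (fun a c c' => ctmul_add _ _ _)
      (fun r a c => ctmul_smul _ _ _))
    (fun a a' c c' => by
      rw [LinearMap.mk₂_apply, LinearMap.mk₂_apply, LinearMap.mk₂_apply, map_mul, ctmul_mul])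
    (fun a c => by rw [LinearMap.mk₂_apply, LinearMap.mk₂_apply, map_star, ctmul_star])

theorem algMapId_atmul (f : A →⋆ₙₐ[ℂ] B) (a : A) (c : C) :
    algMapId f (atmul a c) = ctmul (f a) c :=
  astarLift_atmul _ _ _ a c

theorem algMapId_norm_le (f : A →⋆ₙₐ[ℂ] B) (x : AlgTensor A C) :
    ‖(algMapId f x : CTensor B C)‖ ≤ ‖x‖ := by
  obtain ⟨y, hy, hR⟩ : ∃ y : AlgTensor B C, algMapId f x = CTensor.of y ∧
      ∀ R : RepPair B C, R.rep y = algRep (R.π.comp f) R.ρ x := by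
    induction x using AlgTensor.induction with
    | h0 => exact ⟨0, by rw [map_zero, CTensor.of_zero], fun R => by rw [map_zero, map_zero]⟩
    | htm a c => exact ⟨atmul (f a) c, algMapId_atmul f a c, fun R => by
        rw [algRep_atmul, RepPair.rep, algRep_atmul, NonUnitalStarAlgHom.comp_apply]⟩
    | hadd z w hz hw =>
      obtain ⟨y, hy, hR⟩ := hz
      obtain ⟨y', hy', hR'⟩ := hw
      exact ⟨y + y', by rw [map_add, hy, hy', CTensor.of_add], fun R => by
        rw [map_add, map_add, hR, hR']⟩
  rw [hy, CTensor.norm_of]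
  exact spatialNorm_le fun R => by
    rw [hR]
    exact norm_rep_le ⟨R.H, R.K, R.π.comp f, R.ρ⟩ x

/-- The *-homomorphism `f ⊗ id : A ⊗ C → B ⊗ C`. -/
def tensorMapId (f : A →⋆ₙₐ[ℂ] B) : CTensor A C →⋆ₙₐ[ℂ] CTensor B C :=
  CTensor.starLift (algMapId f) (algMapId_norm_le f)

theorem tensorMapId_ctmul (f : A →⋆ₙₐ[ℂ] B) (a : A) (c : C) :
    tensorMapId f (ctmul a c) = ctmul (f a) c :=
  CTensor.starLift_of _ _ _

end CStarTensor

/-! ### Discrete weak Markov processes -/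

section WeakProcesses

variable {H P : Type*} [NormedAddCommGroup H] [InnerProductSpace ℂ H] [CompleteSpace H]
  [NormedAddCommGroup P] [InnerProductSpace ℂ P] [CompleteSpace P]

/-- The component `V_p = V(· ⊗ p)` of a row isometry `V : H ⊗ P → H`. For `p` in an orthonormal
basis `(ε_k)` of `P` these are the isometries `V_k` with orthogonal ranges. -/
def rowOp (V : HTensor H P →ₗᵢ[ℂ] H) (p : P) : H →L[ℂ] H :=
  V.toContinuousLinearMap ∘L tmulRight H p

/-- `V_α = V_{p₁} ⋯ V_{pₙ}` for a word `α = p₁ ⋯ pₙ`. -/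
def wordOp (V : HTensor H P →ₗᵢ[ℂ] H) : List P → (H →L[ℂ] H)
  | [] => ContinuousLinearMap.id ℂ H
  | p :: α => rowOp V p ∘L wordOp V α

/-- The closed linear span of all `V_α L`: the smallest closed `V`-invariant subspace
containing `L`. -/
def wordSpan (V : HTensor H P →ₗᵢ[ℂ] H) (L : Submodule ℂ H) : Submodule ℂ H :=
  (⨆ α : List P, L.map (wordOp V α).toLinearMap).topologicalClosure

/-- `L` is co-invariant for `V`: `V_p* L ⊆ L` for all `p`. -/
def IsCoinvariant (V : HTensor H P →ₗᵢ[ℂ] H) (L : Submodule ℂ H) : Prop :=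
  ∀ p : P, ∀ ξ ∈ L, (rowOp V p).adjoint ξ ∈ L

variable (H P) in
/-- A discrete weak Markov process `(H, V, 𝔥)` with multiplicity space `P`: a row isometry
`V : H ⊗ P → H` and a closed co-invariant subspace `𝔥` (the internal space) such that `H` is the
closed span of all `V_α 𝔥`. -/
structure WeakProcess where
  V : HTensor H P →ₗᵢ[ℂ] H
  internal : Submodule ℂ H
  isClosed_internal : IsClosed (internal : Set H)
  coinvariant : IsCoinvariant V internal
  minimal : wordSpan V internal = ⊤

namespace WeakProcess

variable (X : WeakProcess H P)

instance : CompleteSpace X.internal := X.isClosed_internal.completeSpace_coe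

/-- The endomorphism `θ(T) = V (T ⊗ 1) V*` of `B(H)`. -/
def endo (T : H →L[ℂ] H) : H →L[ℂ] H :=
  X.V.toContinuousLinearMap ∘L hmap T (ContinuousLinearMap.id ℂ P) ∘L
    X.V.toContinuousLinearMap.adjoint

/-- The operator `x P_𝔥` on `H` for an operator `x` on `𝔥`. -/
def extendInternal (x : X.internal →L[ℂ] X.internal) : H →L[ℂ] H :=
  X.internal.subtypeL ∘L x ∘L X.internal.orthogonalProjectionOnto

/-- The compression of an operator on `H` to `𝔥`. -/
def compress (T : H →L[ℂ] H) : X.internal →L[ℂ] X.internal :=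
  X.internal.orthogonalProjectionOnto ∘L T ∘L X.internal.subtypeL

/-- The transition operator `Z : B(𝔥) → B(𝔥)`, the compression to `𝔥` of `x ↦ θ(x P_𝔥)`. -/
def transition (x : X.internal →L[ℂ] X.internal) : X.internal →L[ℂ] X.internal :=
  X.compress (X.endo (X.extendInternal x))

/-- The observability map `ξ ↦ (C A^α ξ)_α` of the output pair represented by `X` and the output
space `Y`, where `A^α ξ = V_α* ξ` and `C = P_Y`. -/
def observabilityMap (Y : Submodule ℂ H) [Y.HasOrthogonalProjection] (ξ : H) : List P → H :=
  fun α => Y.starProjection ((wordOp X.V α).adjoint ξ)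

/-- A subset of the internal space is observable by the output space `Y` if the observability map
is injective on it. -/
def IsObservableBy (s : Set H) (Y : Submodule ℂ H) [Y.HasOrthogonalProjection] : Prop :=
  Set.InjOn (X.observabilityMap Y) s

/-- A subprocess, given by a closed subspace `𝔤` of `𝔥` which is co-invariant for `V`. It determines
the short exact sequence
`0 → (G, V|G, 𝔤) → (H, V, 𝔥) → (K, V|K, 𝔨) → 0`
with `𝔨 = 𝔥 ⊖ 𝔤` and with `G` and `K` the closed spans of all `V_α 𝔤` and of all `V_α 𝔨`. -/
structure Subprocess where
  internal : Submodule ℂ H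
  isClosed_internal : IsClosed (internal : Set H)
  internal_le : internal ≤ X.internal
  coinvariant : IsCoinvariant X.V internal

namespace Subprocess

variable {X} (S : X.Subprocess)

instance : CompleteSpace S.internal := S.isClosed_internal.completeSpace_coe

/-- The space `G` of the subprocess. -/
def space : Submodule ℂ H := wordSpan X.V S.internal

/-- The internal space `𝔨 = 𝔥 ⊖ 𝔤` of the quotient process. -/
def quotientInternal : Submodule ℂ H := X.internal ⊓ S.internalᗮ

/-- The maximal input space `E^𝔤 = span(𝔤, V(𝔤 ⊗ P)) ⊖ 𝔤` (closed span) of the subprocess. -/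
def wandering : Submodule ℂ H :=
  (S.internal ⊔ ⨆ p : P, S.internal.map (rowOp X.V p).toLinearMap).topologicalClosure ⊓
    S.internalᗮ

instance : CompleteSpace S.wandering :=
  ((Submodule.isClosed_topologicalClosure _).inter
    (Submodule.isClosed_orthogonal _)).completeSpace_coe

/-- The short exact sequence determined by the subprocess is asymptotically complete: `G = H`, that
is, the process is generated by the internal space of the subprocess. (Observability of `𝔨` by the
output space `E^𝔤` follows from this, but is weaker in general.) -/
def AsymptoticallyComplete : Prop := S.space = ⊤

/-- The internal space `𝔨` of the quotient process is observable in `(H, V, 𝔥)` by the output space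
`E^𝔤`. -/
def QuotientObservable : Prop :=
  X.IsObservableBy (S.quotientInternal : Set H) S.wandering

/-- The projection `P_𝔤` as an operator on `𝔥`. -/
def projection : X.internal →L[ℂ] X.internal := X.compress S.internal.starProjection

end Subprocess
end WeakProcess
end WeakProcesses

/-! ### Hilbert space towers and their limits -/

section Towers

/-- A bundled Hilbert space. -/
structure HilbertSpace : Type (u + 1) where
  carrier : Type u
  [norm : NormedAddCommGroup carrier]
  [inner : InnerProductSpace ℂ carrier]
  [complete : CompleteSpace carrier]

attribute [instance] HilbertSpace.norm HilbertSpace.inner HilbertSpace.complete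

/-- `tower h P n` is the Hilbert space `h ⊗ P ⊗ ⋯ ⊗ P` with `n` factors `P`. -/
def tower (h P : Type u) [NormedAddCommGroup h] [InnerProductSpace ℂ h] [CompleteSpace h]
    [NormedAddCommGroup P] [InnerProductSpace ℂ P] : ℕ → HilbertSpace.{u}
  | 0 => ⟨h⟩
  | n + 1 => ⟨HTensor (tower h P n).carrier P⟩

section
variable {h P : Type u} [NormedAddCommGroup h] [InnerProductSpace ℂ h] [CompleteSpace h]
    [NormedAddCommGroup P] [InnerProductSpace ℂ P]

/-- The isometries `w ⊗ 1 ⊗ ⋯ ⊗ 1 : h ⊗ P^{⊗ n} → h ⊗ P^{⊗ (n + 1)}` for an isometry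
`w : h → h ⊗ P`. -/
def towerStep (w : h →ₗᵢ[ℂ] HTensor h P) :
    (n : ℕ) → ((tower h P n).carrier →ₗᵢ[ℂ] (tower h P (n + 1)).carrier)
  | 0 => w
  | n + 1 => hmapIsometry (towerStep w n) LinearIsometry.id
end

variable {E : ℕ → Type u} [∀ n, NormedAddCommGroup (E n)] [∀ n, InnerProductSpace ℂ (E n)]
  (s : (n : ℕ) → (E n →ₗᵢ[ℂ] E (n + 1)))

/-- Sequences that are eventually coherent for the isometries `s`. -/
def coherentSubmodule : Submodule ℂ ((n : ℕ) → E n) where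
  carrier := {x | ∀ᶠ n in atTop, x (n + 1) = s n (x n)}
  zero_mem' := by simp
  add_mem' := fun {x y} hx hy => by
    filter_upwards [hx, hy] with n h1 h2
    simp [h1, h2]
  smul_mem' := fun r x hx => by
    filter_upwards [hx] with n h1
    simp [h1]

/-- The vector space of eventually coherent sequences, to be given the limiting inner product. -/
def CoherentSeq : Type u := coherentSubmodule s

instance : AddCommGroup (CoherentSeq s) := inferInstanceAs (AddCommGroup (coherentSubmodule s))
instance : Module ℂ (CoherentSeq s) := inferInstanceAs (Module ℂ (coherentSubmodule s))

theorem CoherentSeq.inner_eventually_const (x y : CoherentSeq s) :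
    ∃ c : ℂ, ∀ᶠ n in atTop, ⟪x.1 n, y.1 n⟫_ℂ = c := by
  obtain ⟨N, hN⟩ := eventually_atTop.1 (x.2.and y.2)
  refine ⟨⟪x.1 N, y.1 N⟫_ℂ, eventually_atTop.2 ⟨N, fun n hn => ?_⟩⟩
  induction n, hn using Nat.le_induction with
  | base => rfl
  | succ n hn ih => rw [(hN n hn).1, (hN n hn).2, LinearIsometry.inner_map_map, ih]

/-- The inner product of two eventually coherent sequences is the eventual value of
`⟪xₙ, yₙ⟫`. -/
@[reducible] def CoherentSeq.innerCore : PreInnerProductSpace.Core ℂ (CoherentSeq s) where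
  inner x y := (CoherentSeq.inner_eventually_const s x y).choose
  conj_inner_symm x y := by
    obtain ⟨n, h1, h2⟩ := ((CoherentSeq.inner_eventually_const s x y).choose_spec.and
      (CoherentSeq.inner_eventually_const s y x).choose_spec).exists
    change (starRingEnd ℂ) (Exists.choose _) = Exists.choose _
    rw [← h1, ← h2, inner_conj_symm]
  re_inner_nonneg x := by
    obtain ⟨n, h1⟩ := (CoherentSeq.inner_eventually_const s x x).choose_spec.exists
    rw [← h1]
    exact inner_self_nonneg
  add_left x y z := by
    obtain ⟨n, ⟨h1, h2⟩, h3⟩ := (((CoherentSeq.inner_eventually_const s (x + y) z).choose_spec.and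
      (CoherentSeq.inner_eventually_const s x z).choose_spec).and
      (CoherentSeq.inner_eventually_const s y z).choose_spec).exists
    rw [← h1, ← h2, ← h3, ← inner_add_left]
    rfl
  smul_left x y r := by
    obtain ⟨n, h1, h2⟩ := ((CoherentSeq.inner_eventually_const s (r • x) y).choose_spec.and
      (CoherentSeq.inner_eventually_const s x y).choose_spec).exists
    rw [← h1, ← h2, ← inner_smul_left]
    rfl

instance : SeminormedAddCommGroup (CoherentSeq s) :=
  InnerProductSpace.Core.toSeminormedAddCommGroup (c := CoherentSeq.innerCore s)

instance : InnerProductSpace ℂ (CoherentSeq s) :=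
  InnerProductSpace.ofCore (CoherentSeq.innerCore s)

theorem CoherentSeq.inner_eventually (x y : CoherentSeq s) :
    ∀ᶠ n in atTop, ⟪x.1 n, y.1 n⟫_ℂ = ⟪x, y⟫_ℂ :=
  (CoherentSeq.inner_eventually_const s x y).choose_spec

/-- The inductive limit of the Hilbert spaces `E n` along the isometries `s n : E n → E (n + 1)`. -/
def HilbertLimit : Type u := UniformSpace.Completion (CoherentSeq s)

instance : NormedAddCommGroup (HilbertLimit s) :=
  inferInstanceAs (NormedAddCommGroup (UniformSpace.Completion (CoherentSeq s)))

instance : InnerProductSpace ℂ (HilbertLimit s) :=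
  inferInstanceAs (InnerProductSpace ℂ (UniformSpace.Completion (CoherentSeq s)))

instance : CompleteSpace (HilbertLimit s) :=
  inferInstanceAs (CompleteSpace (UniformSpace.Completion (CoherentSeq s)))

/-- The coherent sequence `0, …, 0, x, s x, s (s x), …` starting with `x` at position `m`. -/
def startAt (m : ℕ) : (n : ℕ) → (E m →ₗ[ℂ] E n)
  | 0 => if h : m = 0 then h ▸ LinearMap.id else 0
  | n + 1 => if h : m = n + 1 then h ▸ LinearMap.id else (s n).toLinearMap ∘ₗ startAt m n

theorem startAt_self (m : ℕ) (x : E m) : startAt s m m x = x := by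
  cases m <;> simp [startAt]

theorem startAt_succ {m n : ℕ} (h : m ≤ n) (x : E m) :
    startAt s m (n + 1) x = s n (startAt s m n x) := by
  have : m ≠ n + 1 := by omega
  simp [startAt, this]

theorem startAt_coherent (m : ℕ) (x : E m) : (fun n => startAt s m n x) ∈ coherentSubmodule s :=
  eventually_atTop.2 ⟨m, fun _ hn => startAt_succ s hn x⟩

/-- The map `E m → CoherentSeq s`. -/
def startSeq (m : ℕ) : E m →ₗ[ℂ] CoherentSeq s where
  toFun x := ⟨fun n => startAt s m n x, startAt_coherent s m x⟩
  map_add' x y := Subtype.ext (funext fun _ => map_add _ x y)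
  map_smul' r x := Subtype.ext (funext fun _ => map_smul _ r x)

theorem inner_startAt {m n : ℕ} (h : m ≤ n) (x y : E m) :
    ⟪startAt s m n x, startAt s m n y⟫_ℂ = ⟪x, y⟫_ℂ := by
  induction n, h using Nat.le_induction with
  | base => rw [startAt_self, startAt_self]
  | succ n hn ih => rw [startAt_succ s hn, startAt_succ s hn, LinearIsometry.inner_map_map, ih]

/-- The canonical isometry of `E m` into the inductive limit. -/
def limitEmbed (m : ℕ) : E m →ₗᵢ[ℂ] HilbertLimit s :=
  (UniformSpace.Completion.toComplₗᵢ (𝕜 := ℂ) (E := CoherentSeq s)).comp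
    ((startSeq s m).isometryOfInner fun x y => by
      obtain ⟨n, h1, h2⟩ :=
        ((CoherentSeq.inner_eventually s (startSeq s m x) (startSeq s m y)).and
          (eventually_ge_atTop m)).exists
      rw [← h1]
      exact inner_startAt s h2 x y)

end Towers

/-! ### The minimal isometric dilation of a row coisometry -/

section Dilation

variable {E : ℕ → Type u} [∀ n, NormedAddCommGroup (E n)] [∀ n, InnerProductSpace ℂ (E n)]
  (s : (n : ℕ) → (E n →ₗᵢ[ℂ] E (n + 1)))

/-- The class in the inductive limit of an eventually coherent sequence. -/
def limitMk : CoherentSeq s →ₗᵢ[ℂ] HilbertLimit s :=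
  UniformSpace.Completion.toComplₗᵢ (𝕜 := ℂ) (E := CoherentSeq s)

theorem denseRange_limitMk : DenseRange (limitMk s) := UniformSpace.Completion.denseRange_coe

theorem limitMk_eq {x y : CoherentSeq s} (h : ∀ᶠ n in atTop, x.1 n = y.1 n) :
    limitMk s x = limitMk s y := by
  rw [← sub_eq_zero, ← map_sub, ← norm_eq_zero, LinearIsometry.norm_map,
    ← sq_eq_zero_iff, ← inner_self_eq_norm_sq (𝕜 := ℂ)]
  obtain ⟨n, h1, h2⟩ := ((CoherentSeq.inner_eventually s (x - y) (x - y)).and h).exists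
  have h3 : (x - y).1 n = 0 := by
    change x.1 n - y.1 n = 0
    rw [h2, sub_self]
  rw [← h1, h3, inner_zero_left, map_zero]

theorem limitEmbed_eq (m : ℕ) (x : E m) : limitEmbed s m x = limitMk s (startSeq s m x) := rfl

theorem limitEmbed_succ (m : ℕ) (x : E m) : limitEmbed s (m + 1) (s m x) = limitEmbed s m x := by
  rw [limitEmbed_eq, limitEmbed_eq]
  refine limitMk_eq s (eventually_atTop.2 ⟨m + 1, fun n hn => ?_⟩)
  change startAt s (m + 1) n (s m x) = startAt s m n x
  induction n, hn using Nat.le_induction with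
  | base => rw [startAt_self, startAt_succ s le_rfl, startAt_self]
  | succ n hn ih => rw [startAt_succ s hn, startAt_succ s (by omega), ih]

theorem exists_limitMk_eq (x : CoherentSeq s) : ∃ m, ∃ y : E m, limitMk s x = limitEmbed s m y := by
  obtain ⟨N, hN⟩ := eventually_atTop.1 x.2
  refine ⟨N, x.1 N, limitMk_eq s (eventually_atTop.2 ⟨N, fun n hn => ?_⟩)⟩
  change x.1 n = startAt s N n (x.1 N)
  induction n, hn using Nat.le_induction with
  | base => rw [startAt_self]
  | succ n hn ih => rw [hN n hn, startAt_succ s hn, ← ih]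

variable {h P : Type u} [NormedAddCommGroup h] [InnerProductSpace ℂ h] [CompleteSpace h]
    [NormedAddCommGroup P] [InnerProductSpace ℂ P] (w : h →ₗᵢ[ℂ] HTensor h P)

theorem towerStep_htmul (n : ℕ) (x : (tower h P n).carrier) (p : P) :
    towerStep w (n + 1) (htmul x p) = htmul (towerStep w n x) p :=
  hmapIsometry_htmul _ _ x p

/-- The sequence `0, x₀ ⊗ p, x₁ ⊗ p, …`. -/
def shiftSeq (x : CoherentSeq (towerStep w)) (p : P) : CoherentSeq (towerStep w) :=
  ⟨fun n => match n with
    | 0 => (0 : (tower h P 0).carrier)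
    | n + 1 => (htmul (x.1 n) p : HTensor (tower h P n).carrier P), by
    obtain ⟨N, hN⟩ := eventually_atTop.1 x.2
    refine eventually_atTop.2 ⟨N + 1, fun n hn => ?_⟩
    obtain ⟨k, rfl⟩ : ∃ k, n = k + 1 := ⟨n - 1, by omega⟩
    change htmul (x.1 (k + 1)) p = towerStep w (k + 1) (htmul (x.1 k) p)
    rw [towerStep_htmul, hN k (by omega)]⟩

theorem shiftSeq_inner (x y : CoherentSeq (towerStep w)) (p q : P) :
    ⟪shiftSeq w x p, shiftSeq w y q⟫_ℂ = ⟪x, y⟫_ℂ * ⟪p, q⟫_ℂ := by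
  have h1 := (tendsto_add_atTop_nat 1).eventually
    (CoherentSeq.inner_eventually _ (shiftSeq w x p) (shiftSeq w y q))
  obtain ⟨n, h1, h2⟩ := (h1.and (CoherentSeq.inner_eventually _ x y)).exists
  rw [← h1, ← h2]
  exact inner_htmul _ _ _ _

/-- The operator `V_p` on the inductive limit. -/
def shiftOp (p : P) : HilbertLimit (towerStep w) →L[ℂ] HilbertLimit (towerStep w) :=
  ContinuousLinearMap.completion (α := CoherentSeq (towerStep w)) (β := CoherentSeq (towerStep w))
    (LinearMap.mkContinuous
      { toFun := fun x => shiftSeq w x p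
        map_add' := fun x y => Subtype.ext (funext fun n => by
          cases n with
          | zero => exact (add_zero (0 : h)).symm
          | succ n => exact add_htmul (x.1 n) (y.1 n) p)
        map_smul' := fun r x => Subtype.ext (funext fun n => by
          cases n with
          | zero => exact (smul_zero r : r • (0 : h) = 0).symm
          | succ n => exact smul_htmul r (x.1 n) p) } ‖p‖
      fun x => by
        refine le_of_eq ?_
        change ‖shiftSeq w x p‖ = _
        rw [← sq_eq_sq₀ (norm_nonneg _) (by positivity), ← inner_self_eq_norm_sq (𝕜 := ℂ),
          shiftSeq_inner, inner_self_eq_norm_sq_to_K, inner_self_eq_norm_sq_to_K, mul_pow,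
          mul_comm]
        norm_cast)

theorem shiftOp_mk (p : P) (x : CoherentSeq (towerStep w)) :
    shiftOp w p (limitMk _ x) = limitMk _ (shiftSeq w x p) :=
  ContinuousLinearMap.completion_apply_coe _ _

theorem limit_induction {p : HilbertLimit s → Prop} (hp : IsClosed {x | p x})
    (h : ∀ x, p (limitMk s x)) (x : HilbertLimit s) : p x :=
  (denseRange_limitMk s).induction_on x hp h

theorem shiftSeq_add (x : CoherentSeq (towerStep w)) (p q : P) :
    shiftSeq w x (p + q) = shiftSeq w x p + shiftSeq w x q :=
  Subtype.ext (funext fun n => by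
    cases n with
    | zero => exact (add_zero (0 : h)).symm
    | succ n => exact htmul_add (x.1 n) p q)

theorem shiftSeq_smul (r : ℂ) (x : CoherentSeq (towerStep w)) (p : P) :
    shiftSeq w x (r • p) = r • shiftSeq w x p :=
  Subtype.ext (funext fun n => by
    cases n with
    | zero => exact (smul_zero r : r • (0 : h) = 0).symm
    | succ n => exact htmul_smul r (x.1 n) p)

/-- The bilinear map `(x, p) ↦ V_p x` on the inductive limit. -/
def shiftBilin : HilbertLimit (towerStep w) →ₗ[ℂ] P →ₗ[ℂ] HilbertLimit (towerStep w) :=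
  LinearMap.mk₂ ℂ (fun x p => shiftOp w p x)
    (fun x y p => map_add _ x y)
    (fun r x p => map_smul _ r x)
    (fun x p q => by
      induction x using limit_induction with
      | hp =>
        exact isClosed_eq (shiftOp w (p + q)).continuous
          ((shiftOp w p).continuous.add (shiftOp w q).continuous)
      | h x => rw [shiftOp_mk, shiftOp_mk, shiftOp_mk, ← map_add, shiftSeq_add])
    (fun r x p => by
      induction x using limit_induction with
      | hp =>
        exact isClosed_eq (shiftOp w (r • p)).continuous ((shiftOp w p).continuous.const_smul r)
      | h x => rw [shiftOp_mk, shiftOp_mk, ← map_smul, shiftSeq_smul])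

/-- The row isometry of the minimal isometric dilation of `w*`. -/
def dilationIsometry :
    HTensor (HilbertLimit (towerStep w)) P →ₗᵢ[ℂ] HilbertLimit (towerStep w) :=
  hlift (shiftBilin w) fun x y p q => by
    change ⟪shiftOp w p x, shiftOp w q y⟫_ℂ = _
    induction x using limit_induction with
    | hp => exact isClosed_eq (by fun_prop) (by fun_prop)
    | h x =>
      induction y using limit_induction with
      | hp => exact isClosed_eq (by fun_prop) (by fun_prop)
      | h y =>
        rw [shiftOp_mk, shiftOp_mk, LinearIsometry.inner_map_map, LinearIsometry.inner_map_map,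
          shiftSeq_inner]

theorem dilationIsometry_embed (n : ℕ) (x : (tower h P n).carrier) (p : P) :
    dilationIsometry w (htmul (limitEmbed (towerStep w) n x) p) =
      limitEmbed (towerStep w) (n + 1) (htmul x p) := by
  rw [dilationIsometry, hlift_htmul]
  change shiftOp w p (limitEmbed (towerStep w) n x) = _
  rw [limitEmbed_eq, shiftOp_mk]
  refine limitMk_eq (y := startSeq (towerStep w) (n + 1) (htmul x p)) _ (eventually_atTop.2 ⟨n + 1, fun m hm => ?_⟩)
  change (shiftSeq w _ p).1 m = startAt (towerStep w) (n + 1) m (htmul x p)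
  induction m, hm using Nat.le_induction with
  | base =>
    exact (congrArg (fun z => htmul z p) (startAt_self (towerStep w) n x)).trans
      (startAt_self (towerStep w) (n + 1) (htmul x p)).symm
  | succ m hm ih =>
    refine Eq.trans ?_ ((congrArg (towerStep w m) ih).trans
      (startAt_succ (towerStep w) hm (htmul x p)).symm)
    obtain ⟨k, rfl⟩ : ∃ k, m = k + 1 := ⟨m - 1, by omega⟩
    change htmul (startAt (towerStep w) n (k + 1) x) p
      = towerStep w (k + 1) (htmul (startAt (towerStep w) n k x) p)
    rw [towerStep_htmul, startAt_succ _ (by omega)]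

/-- The embedding of `h` into the dilation space. -/
def dilationEmbed : h →ₗᵢ[ℂ] HilbertLimit (towerStep w) := limitEmbed (towerStep w) 0

theorem dilationIsometry_map (z : HTensor h P) :
    dilationIsometry w (hmapIsometry (dilationEmbed w) LinearIsometry.id z) =
      limitEmbed (towerStep w) 1 z := by
  induction z using HTensor.induction with
  | hp =>
    exact isClosed_eq (by fun_prop) (limitEmbed (towerStep w) 1).continuous
  | h0 =>
    rw [map_zero, map_zero]; exact (map_zero (limitEmbed (towerStep w) 1)).symm
  | htm x y => rw [hmapIsometry_htmul]; exact dilationIsometry_embed w 0 x y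
  | hadd z y hz hy =>
    rw [map_add, map_add, hz, hy]
    exact (map_add (limitEmbed (towerStep w) 1) z y).symm

theorem dilation_adjoint (ξ : h) :
    (dilationIsometry w).toContinuousLinearMap.adjoint (dilationEmbed w ξ) =
      hmapIsometry (dilationEmbed w) LinearIsometry.id (w ξ) := by
  have h1 : dilationEmbed w ξ =
      dilationIsometry w (hmapIsometry (dilationEmbed w) LinearIsometry.id (w ξ)) := by
    rw [dilationIsometry_map]
    exact (limitEmbed_succ (towerStep w) 0 ξ).symm
  refine ext_inner_left ℂ fun y => ?_
  rw [ContinuousLinearMap.adjoint_inner_right, h1]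
  exact (dilationIsometry w).inner_map_map _ _

variable [CompleteSpace P]

/-- The minimal isometric dilation of the row coisometry `w* : h ⊗ P → h`, as a weak process. -/
def dilation : WeakProcess (HilbertLimit (towerStep w)) P where
  V := dilationIsometry w
  internal := LinearMap.range (dilationEmbed w).toLinearMap
  isClosed_internal := (dilationEmbed w).isometry.isClosedEmbedding.isClosed_range
  coinvariant := by
    rintro p _ ⟨ξ, rfl⟩
    refine ⟨(tmulRight h p).adjoint (w ξ), ?_⟩
    rw [rowOp, ContinuousLinearMap.adjoint_comp]
    change _ = (tmulRight _ p).adjoint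
      ((dilationIsometry w).toContinuousLinearMap.adjoint (dilationEmbed w ξ))
    rw [dilation_adjoint, tmulRight_adjoint_hmapIsometry]
    rfl
  minimal := by
    set L := LinearMap.range (dilationEmbed w).toLinearMap
    have hcl : IsClosed (wordSpan (dilationIsometry w) L : Set (HilbertLimit (towerStep w))) :=
      Submodule.isClosed_topologicalClosure _
    have hinv : ∀ p : P, ∀ x ∈ wordSpan (dilationIsometry w) L,
        dilationIsometry w (htmul x p) ∈ wordSpan (dilationIsometry w) L := by
      intro p x hx
      have hle : wordSpan (dilationIsometry w) L ≤
          (wordSpan (dilationIsometry w) L).comap (rowOp (dilationIsometry w) p).toLinearMap := by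
        refine Submodule.topologicalClosure_minimal _ (iSup_le fun α => ?_)
          (hcl.preimage (rowOp (dilationIsometry w) p).continuous)
        rintro _ ⟨ξ, hξ, rfl⟩
        exact Submodule.le_topologicalClosure _ (Submodule.mem_iSup_of_mem (p :: α) ⟨ξ, hξ, rfl⟩)
      exact hle hx
    have hn : ∀ n, ∀ x : (tower h P n).carrier,
        limitEmbed (towerStep w) n x ∈ wordSpan (dilationIsometry w) L := by
      intro n
      induction n with
      | zero =>
        intro x
        exact Submodule.le_topologicalClosure _ (Submodule.mem_iSup_of_mem [] ⟨_, ⟨x, rfl⟩, rfl⟩)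
      | succ n ih =>
        intro x
        change HTensor (tower h P n).carrier P at x
        induction x using HTensor.induction with
        | hp => exact hcl.preimage (limitEmbed (towerStep w) (n + 1)).continuous
        | h0 =>
          have := map_zero (limitEmbed (towerStep w) (n + 1))
          exact this ▸ zero_mem _
        | htm x y => exact dilationIsometry_embed w n x y ▸ hinv y _ (ih x)
        | hadd z y hz hy =>
          have := map_add (limitEmbed (towerStep w) (n + 1)) z y
          exact this ▸ add_mem hz hy
    rw [eq_top_iff]
    rintro x -
    induction x using limit_induction with
    | hp => exact hcl
    | h x =>
      obtain ⟨m, y, hy⟩ := exists_limitMk_eq _ x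
      exact hy ▸ hn m y

end Dilation

/-! ### Stationary noncommutative Markov chains -/

section Chains

variable {A C : Type u} [CStarAlgebra A] [PartialOrder A] [StarOrderedRing A]
  [CStarAlgebra C] [PartialOrder C] [StarOrderedRing C]

/-- The cyclic vector `Ω_φ` of the GNS representation of `φ`. -/
def cyclicVec (φ : A →ₚ[ℂ] ℂ) : φ.GNS := (φ.toPreGNS 1 : φ.PreGNS)

theorem inner_cyclicVec (φ : A →ₚ[ℂ] ℂ) (a : A) :
    ⟪cyclicVec φ, φ.gnsNonUnitalStarAlgHom a (cyclicVec φ)⟫_ℂ = φ a := by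
  simp [cyclicVec, PositiveLinearMap.preGNS_inner_def, UniformSpace.Completion.inner_coe]

theorem norm_cyclicVec (φ : A →ₚ[ℂ] ℂ) (h : φ 1 = 1) : ‖cyclicVec φ‖ = 1 := by
  simp [cyclicVec, PositiveLinearMap.preGNS_norm_def, UniformSpace.Completion.norm_coe, h]

/-- The functional `φ ⊗ ψ` on the spatial tensor product `A ⊗ C`. -/
def productState (φ : A →ₚ[ℂ] ℂ) (ψ : C →ₚ[ℂ] ℂ) (x : CTensor A C) : ℂ :=
  ⟪htmul (cyclicVec φ) (cyclicVec ψ),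
    tensorRep φ.gnsNonUnitalStarAlgHom ψ.gnsNonUnitalStarAlgHom x
      (htmul (cyclicVec φ) (cyclicVec ψ))⟫_ℂ

theorem productState_ctmul (φ : A →ₚ[ℂ] ℂ) (ψ : C →ₚ[ℂ] ℂ) (a : A) (c : C) :
    productState φ ψ (ctmul a c) = φ a * ψ c := by
  rw [productState, tensorRep_ctmul, hmap_htmul, inner_htmul, inner_cyclicVec, inner_cyclicVec]

variable (A C) in
/-- A stationary noncommutative Markov chain: states `φ` on `A` and `ψ` on `C` and a
*-homomorphism `j : A → A ⊗ C` with `(φ ⊗ ψ) ∘ j = φ`. (In particular `j` is non-zero. It need not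
be unital.) -/
structure StationaryMarkovChain where
  φ : A →ₚ[ℂ] ℂ
  φ_one : φ 1 = 1
  ψ : C →ₚ[ℂ] ℂ
  ψ_one : ψ 1 = 1
  j : A →⋆ₙₐ[ℂ] CTensor A C
  stationary : ∀ a, productState φ ψ (j a) = φ a

/-- A bundled C*-algebra. -/
structure CStarAlg : Type (u + 1) where
  carrier : Type u
  [str : CStarAlgebra carrier]

attribute [instance] CStarAlg.str

variable (A C) in
/-- `algTower A C n` is the C*-algebra `A ⊗ C ⊗ ⋯ ⊗ C` with `n` factors `C`. -/
def algTower : ℕ → CStarAlg.{u}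
  | 0 => ⟨A⟩
  | n + 1 => ⟨CTensor (algTower n).carrier C⟩

namespace StationaryMarkovChain

variable (M : StationaryMarkovChain A C)

/-- The GNS Hilbert space `𝔥` of `(A, φ)`. -/
abbrev h : Type u := M.φ.GNS

/-- The GNS Hilbert space `P` of `(C, ψ)`. -/
abbrev P : Type u := M.ψ.GNS

/-- The cyclic vector `Ω_φ`. -/
abbrev Ωφ : M.h := cyclicVec M.φ

/-- The cyclic vector `Ω_ψ`. -/
abbrev Ωψ : M.P := cyclicVec M.ψ

/-- The vector `a Ω_φ`. -/
def vec (a : A) : M.h := M.φ.gnsNonUnitalStarAlgHom a M.Ωφ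

/-- The noncommutative random variables `j_n : A → A ⊗ C^{⊗ n}`, given by `j_0 = id` and
`j_{n+1} = (j_n ⊗ id) ∘ j`. -/
def rv : (n : ℕ) → (A →⋆ₙₐ[ℂ] (algTower A C n).carrier)
  | 0 => NonUnitalStarAlgHom.id ℂ A
  | n + 1 => (tensorMapId (rv n)).comp M.j

/-- The Hilbert space `𝔥 ⊗ P^{⊗ n} = L²(A ⊗ C^{⊗ n}, φ ⊗ ψ^{⊗ n})`. -/
abbrev L2 (n : ℕ) : Type u := (tower M.h M.P n).carrier

/-- The GNS representation of `A ⊗ C^{⊗ n}` on `𝔥 ⊗ P^{⊗ n}`. -/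
def rep : (n : ℕ) → ((algTower A C n).carrier →⋆ₙₐ[ℂ] (M.L2 n →L[ℂ] M.L2 n))
  | 0 => M.φ.gnsNonUnitalStarAlgHom
  | n + 1 => tensorRep (rep n) M.ψ.gnsNonUnitalStarAlgHom

/-- The cyclic vector `Ω_φ ⊗ Ω_ψ ⊗ ⋯ ⊗ Ω_ψ` of `𝔥 ⊗ P^{⊗ n}`. -/
def vacuum : (n : ℕ) → M.L2 n
  | 0 => M.Ωφ
  | n + 1 => htmul (vacuum n) M.Ωψ

/-- The random variable `j_n(a)` as the vector `j_n(a) Ω_φ ⊗ Ω_ψ^{⊗ n}` of `L²(A ⊗ C^{⊗ n})`. -/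
def rvVec (n : ℕ) (a : A) : M.L2 n := M.rep n (M.rv n a) (M.vacuum n)

/-- The closed subspace `Ω_φ ⊗ P^{⊗ n} = L²(1 ⊗ C^{⊗ n})` of `𝔥 ⊗ P^{⊗ n}`. -/
def noise : (n : ℕ) → Submodule ℂ (M.L2 n)
  | 0 => ℂ ∙ M.Ωφ
  | n + 1 => tensorSpan M.P (noise n)

theorem isClosed_noise (n : ℕ) : IsClosed (M.noise n : Set (M.L2 n)) := by
  cases n with
  | zero => exact (ℂ ∙ M.Ωφ).closed_of_finiteDimensional
  | succ n => exact isClosed_tensorSpan M.P (M.noise n)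

instance (n : ℕ) : CompleteSpace (M.noise n) := (M.isClosed_noise n).completeSpace_coe

/-! #### Scattering -/

/-- The isometry `𝔥 → 𝔥 ⊗ P`, `ξ ↦ ξ ⊗ Ω_ψ`, which represents `a ↦ a ⊗ 1`. -/
def freeStep : M.h →ₗᵢ[ℂ] HTensor M.h M.P :=
  { (tmulRight M.h M.Ωψ).toLinearMap with
    norm_map' := fun ξ => by
      change ‖htmul ξ M.Ωψ‖ = ‖ξ‖
      rw [norm_htmul, norm_cyclicVec M.ψ M.ψ_one, mul_one] }

/-- The Hilbert space `L²(A ⊗ C_{(-∞,-1]})` of the chain algebra and the noise at all negative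
times: the limit of `L²(A ⊗ C^{⊗ n})`, whose `n` noise factors sit at the times `-n, …, -1`, as
`n → ∞`. A new factor is adjoined next to `A` and is filled with `Ω_ψ`. -/
abbrev PastSpace : Type u := HilbertLimit (towerStep M.freeStep)

/-- The vector of `S⁻ⁿ Tⁿ(a)` in `L²(A ⊗ C_{(-∞,-1]})`, where `S` is the free evolution (the shift
of the noise by one step, trivial on `A`) and `T` the evolution of the chain: `Tⁿ(a) = j_n(a)` lies
in `A ⊗ C_{[0,n-1]}`, and `S⁻ⁿ` moves it to `A ⊗ C_{[-n,-1]}`. -/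
def scattered (n : ℕ) (a : A) : M.PastSpace := limitEmbed (towerStep M.freeStep) n (M.rvVec n a)

/-- The closed subspace `L²(1 ⊗ C_{(-∞,-1]})` of the noise. -/
def pastNoise : Submodule ℂ M.PastSpace :=
  (⨆ n : ℕ, (M.noise n).map (limitEmbed (towerStep M.freeStep) n).toLinearMap).topologicalClosure

/-- The chain is asymptotically complete in the sense of scattering theory: for all `a` in `A` the
limit `Φ(a) = lim S⁻ⁿ Tⁿ(a)` exists (in the norm `‖·‖₂` of the state) and belongs to the noise. -/
def ScatteringComplete : Prop :=
  ∀ a : A, ∃ y ∈ M.pastNoise, Tendsto (fun n => M.scattered n a) atTop (𝓝 y)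

/-- The criterion `‖E(j_n(a))‖₂ → ‖a‖₂` for all `a`, where `E` is the conditional expectation onto
`1 ⊗ C^{⊗ n}` given by the state `φ` on `A`; on `L²` it is the projection onto `Ω_φ ⊗ P^{⊗ n}`. -/
def NoiseNormComplete : Prop :=
  ∀ a : A, Tendsto (fun n => ‖(M.noise n).starProjection (M.rvVec n a)‖) atTop (𝓝 ‖M.vec a‖)

/-! #### The associated weak process -/

/-- The representation `π_φ ⊗ π_ψ` of `A ⊗ C` on `𝔥 ⊗ P`. -/
abbrev rep₁ : CTensor A C →⋆ₙₐ[ℂ] (HTensor M.h M.P →L[ℂ] HTensor M.h M.P) :=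
  tensorRep M.φ.gnsNonUnitalStarAlgHom M.ψ.gnsNonUnitalStarAlgHom

/-- The vector `j(a) Ω_φ ⊗ Ω_ψ`. -/
def stepVec (a : A) : HTensor M.h M.P := M.rep₁ (M.j a) (htmul M.Ωφ M.Ωψ)

theorem inner_stepVec (a b : A) : ⟪M.stepVec a, M.stepVec b⟫_ℂ = M.φ (star a * b) := by
  rw [← M.stationary, productState, map_mul, map_star, map_mul, map_star,
    ContinuousLinearMap.star_eq_adjoint, mul_apply_eq_comp,
    ContinuousLinearMap.adjoint_inner_right]
  rfl

theorem vec_eq (a : A) : M.vec a = (M.φ.toPreGNS a : M.φ.PreGNS) := by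
  simp [vec, cyclicVec]

/-- The linear map `a Ω_φ ↦ j(a) Ω_φ ⊗ Ω_ψ` on `A`, with the norm of `𝔥`. -/
def stepPre : M.φ.PreGNS →ₗᵢ[ℂ] HTensor M.h M.P :=
  LinearMap.isometryOfInner
    { toFun := fun a => M.stepVec (M.φ.ofPreGNS a)
      map_add' := fun a b => by simp only [stepVec, map_add, add_apply]
      map_smul' := fun r a => by simp only [stepVec, map_smul, smul_apply, RingHom.id_apply] }
    fun a b => M.inner_stepVec _ _

/-- The associated isometry `v₁ : 𝔥 → 𝔥 ⊗ P`, `a Ω_φ ↦ j(a) Ω_φ ⊗ Ω_ψ`. -/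
def v₁ : M.h →ₗᵢ[ℂ] HTensor M.h M.P :=
  let g : M.h →L[ℂ] HTensor M.h M.P := M.stepPre.toContinuousLinearMap.fromCompletion
  { g with
    norm_map' := fun ξ => by
      change ‖g ξ‖ = ‖ξ‖
      induction ξ using UniformSpace.Completion.induction_on with
      | hp => exact isClosed_eq (by fun_prop) (by fun_prop)
      | ih a =>
        have : g a = M.stepPre a :=
          ContinuousLinearMap.fromCompletion_apply_coe M.stepPre.toContinuousLinearMap a
        rw [this, LinearIsometry.norm_map, UniformSpace.Completion.norm_coe] }

theorem v₁_vec (a : A) : M.v₁ (M.vec a) = M.stepVec a := by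
  rw [vec_eq]
  exact ContinuousLinearMap.fromCompletion_apply_coe M.stepPre.toContinuousLinearMap _

theorem v₁_Ωφ : M.v₁ M.Ωφ = htmul M.Ωφ M.Ωψ := by
  have h1 : M.vec 1 = M.Ωφ := by rw [vec_eq]; rfl
  have hn : ‖htmul M.Ωφ M.Ωψ‖ = 1 := by
    rw [norm_htmul, norm_cyclicVec _ M.φ_one, norm_cyclicVec _ M.ψ_one, one_mul]
  have hi : ⟪htmul M.Ωφ M.Ωψ, M.stepVec 1⟫_ℂ = 1 := (M.stationary 1).trans M.φ_one
  rw [← h1, v₁_vec, h1]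
  have hs : ‖M.stepVec 1‖ = 1 := by
    rw [← v₁_vec, LinearIsometry.norm_map, h1, norm_cyclicVec _ M.φ_one]
  exact ((inner_eq_one_iff_of_norm_eq_one (𝕜 := ℂ) hn hs).1 hi).symm

/-- `(X, ι)` is the weak process associated to the chain, where the isometry `ι` identifies the GNS
space `𝔥` with the internal space of `X`: on `𝔥` the adjoint `V*` is the associated isometry `v₁`.
In other words, `V` is the minimal isometric dilation of `v₁* : 𝔥 ⊗ P → 𝔥`. -/
structure IsAssociated {H : Type u} [NormedAddCommGroup H] [InnerProductSpace ℂ H]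
    [CompleteSpace H] (X : WeakProcess H M.P) (ι : M.h →ₗᵢ[ℂ] H) : Prop where
  range_eq : LinearMap.range ι.toLinearMap = X.internal
  adjoint_eq : ∀ ξ : M.h, X.V.toContinuousLinearMap.adjoint (ι ξ) =
    hmapIsometry ι LinearIsometry.id (M.v₁ ξ)

/-- The associated weak process exists. -/
theorem isAssociated_dilation : M.IsAssociated (dilation M.v₁) (dilationEmbed M.v₁) where
  range_eq := rfl
  adjoint_eq := dilation_adjoint M.v₁

/-- The subprocess of the associated process with the one-dimensional internal space
`𝔤 = ℂ Ω_φ`. -/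
def IsAssociated.subprocess {M : StationaryMarkovChain A C} {H : Type u} [NormedAddCommGroup H]
    [InnerProductSpace ℂ H] [CompleteSpace H] {X : WeakProcess H M.P} {ι : M.h →ₗᵢ[ℂ] H}
    (hX : M.IsAssociated X ι) : X.Subprocess where
  internal := ℂ ∙ ι M.Ωφ
  isClosed_internal := (ℂ ∙ ι M.Ωφ).closed_of_finiteDimensional
  internal_le := by
    rw [Submodule.span_singleton_le_iff_mem, ← hX.range_eq]
    exact ⟨M.Ωφ, rfl⟩
  coinvariant := by
    intro p ξ hξ
    obtain ⟨c, rfl⟩ := Submodule.mem_span_singleton.1 hξ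
    rw [map_smul, rowOp, ContinuousLinearMap.adjoint_comp]
    change c • (tmulRight H p).adjoint (X.V.toContinuousLinearMap.adjoint (ι M.Ωφ)) ∈ _
    rw [hX.adjoint_eq, tmulRight_adjoint_hmapIsometry, v₁_Ωφ, tmulRight_adjoint_htmul, map_smul]
    exact Submodule.smul_mem _ _ (Submodule.smul_mem _ _ (Submodule.mem_span_singleton_self _))

end StationaryMarkovChain
end Chains

end

end WeakMarkov

open WeakMarkov

/-!
Write `v_n : 𝔥 → 𝔥 ⊗ P^{⊗ n}` for the iterates of the associated isometry `v₁`. They represent the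
random variables, `j_n(a) Ω = v_n (a Ω_φ)` (`rvVec_eq`), and satisfy both `v_{n+1} = (v_n ⊗ 1) v₁`
and `v_{n+1} = (v₁ ⊗ 1 ⊗ ⋯ ⊗ 1) v_n`. Let `Q_n` be the projection onto the noise
`Ω_φ ⊗ P^{⊗ n}`. All four conditions are equivalent to

  `‖v_n ξ - Q_n v_n ξ‖ → 0` for all `ξ` in `𝔥`,

the convergence to `0` of `noiseDefect`. The reason is that `v₁ Ω_φ = Ω_φ ⊗ Ω_ψ`: on the noise a
step of the chain is a step of the free evolution (`towerStep_of_mem_noise`). Therefore the defect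
decreases in `n`, and a single good approximation of some `v_n ξ` by noise controls all later ones.

* The norm criterion is Pythagoras' theorem, together with the density of the vectors `a Ω_φ`.
* Scattering: the noise part of `v_n ξ`, as an element of the limit space, stays at the constant
  distance `noiseDefect ξ n` from `S⁻ᵏ Tᵏ(a)` for all `k ≥ n`, where `ξ = a Ω_φ`; hence
  small defects give a Cauchy sequence whose limit lies in the noise. Conversely, a limit in the
  noise is approximated by vectors in some `Ω_φ ⊗ P^{⊗ n}`.
* Weak processes: the isometries `unroll n : 𝔥 ⊗ P^{⊗ n} → H` built from `V` satisfy
  `unroll n (v_n ξ) = ξ`, and `G` is the closure of the union of the images of the noise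
  (`space_eq`). By minimality `G = H` holds if and only if `𝔥 ⊆ G`.
* Transition operator: `Zⁿ(P_𝔤) = v_n* Q_n v_n`, and for a projection compressed by an isometry
  strong convergence to `1` is convergence of the norms `‖Q_n v_n ξ‖`.

Observability: if `ζ ∈ 𝔨` is annihilated by all `P_E V_α*`, then `ζ` is orthogonal to all `V_α E` and
to `𝔤`, hence by induction on the length of `α` to all `V_α 𝔤`, that is, to `G`.
-/

namespace WeakMarkov

noncomputable section

/-! ### Operators on Hilbert space tensor products -/

section HilbertTensor

variable {E F G H : Type*}
  [NormedAddCommGroup E] [InnerProductSpace ℂ E] [NormedAddCommGroup F] [InnerProductSpace ℂ F]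
  [NormedAddCommGroup G] [InnerProductSpace ℂ G] [NormedAddCommGroup H] [InnerProductSpace ℂ H]

theorem hmap_comp {E' F' : Type*} [NormedAddCommGroup E'] [InnerProductSpace ℂ E']
    [NormedAddCommGroup F'] [InnerProductSpace ℂ F'] (f : G →L[ℂ] E') (f' : E →L[ℂ] G)
    (g : H →L[ℂ] F') (g' : F →L[ℂ] H) : hmap (f ∘L f') (g ∘L g') = hmap f g ∘L hmap f' g' :=
  hext fun x y => by simp [hmap_htmul]

theorem hmap_adjoint [CompleteSpace E] [CompleteSpace F] [CompleteSpace G] [CompleteSpace H]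
    (f : E →L[ℂ] G) (g : F →L[ℂ] H) : hmap f.adjoint g.adjoint = (hmap f g).adjoint := by
  rw [ContinuousLinearMap.eq_adjoint_iff]
  intro z w
  induction z using HTensor.induction with
  | hp => apply isClosed_eq <;> fun_prop
  | h0 => simp
  | hadd a b ha hb => rw [map_add, inner_add_left, inner_add_left, ha, hb]
  | htm x y =>
    induction w using HTensor.induction with
    | hp => apply isClosed_eq <;> fun_prop
    | h0 => simp
    | hadd a b ha hb => rw [map_add, inner_add_right, inner_add_right, ha, hb]
    | htm x' y' => simp only [hmap_htmul, inner_htmul, ContinuousLinearMap.adjoint_inner_left]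

/-- Compressing by `(f ⊗ 1) w` is compressing by `f` in the first leg and then by `w`. -/
theorem adjoint_comp_hmap_comp [CompleteSpace E] [CompleteSpace F] [CompleteSpace G]
    [CompleteSpace H] (w : H →L[ℂ] HTensor E F) (f : E →L[ℂ] G) (Q : G →L[ℂ] G) :
    (hmap f (ContinuousLinearMap.id ℂ F) ∘L w).adjoint ∘L hmap Q (ContinuousLinearMap.id ℂ F) ∘L
      hmap f (ContinuousLinearMap.id ℂ F) ∘L w =
    w.adjoint ∘L hmap (f.adjoint ∘L Q ∘L f) (ContinuousLinearMap.id ℂ F) ∘L w := by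
  have h : hmap (f.adjoint ∘L Q ∘L f) (ContinuousLinearMap.id ℂ F) =
      (hmap f (ContinuousLinearMap.id ℂ F)).adjoint ∘L hmap Q (ContinuousLinearMap.id ℂ F) ∘L
        hmap f (ContinuousLinearMap.id ℂ F) := by
    rw [← hmap_adjoint, ContinuousLinearMap.adjoint_id, ← hmap_comp, ← hmap_comp,
      ContinuousLinearMap.id_comp, ContinuousLinearMap.id_comp]
  rw [h, ContinuousLinearMap.adjoint_comp]
  rfl

theorem tensorSpan_le {L : Submodule ℂ E} {K : Submodule ℂ (HTensor E F)}
    (hK : IsClosed (K : Set (HTensor E F))) (h : ∀ x ∈ L, ∀ p : F, htmul x p ∈ K) :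
    tensorSpan F L ≤ K := by
  refine Submodule.topologicalClosure_minimal _ (iSup_le fun p => ?_) hK
  rintro _ ⟨x, hx, rfl⟩
  exact h x hx p

/-- The projection onto `L ⊗ F` is `P_L ⊗ 1`. -/
theorem starProjection_tensorSpan (L : Submodule ℂ E) [L.HasOrthogonalProjection]
    [(tensorSpan F L).HasOrthogonalProjection] :
    (tensorSpan F L).starProjection = hmap L.starProjection (ContinuousLinearMap.id ℂ F) := by
  refine hext fun x y => ?_
  rw [hmap_htmul]
  refine Submodule.eq_starProjection_of_mem_of_inner_eq_zero
    (htmul_mem_tensorSpan (L.starProjection_apply_mem x) _) fun w hw => ?_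
  suffices h : tensorSpan F L ≤
      (ℂ ∙ (htmul x y - htmul (L.starProjection x) y : HTensor E F))ᗮ from
    Submodule.mem_orthogonal_singleton_iff_inner_right.1 (h hw)
  refine tensorSpan_le (Submodule.isClosed_orthogonal _) fun v hv p => ?_
  rw [Submodule.mem_orthogonal_singleton_iff_inner_right, inner_sub_left, inner_htmul, inner_htmul,
    ← sub_mul, ← inner_sub_left, Submodule.starProjection_inner_eq_zero x v hv, zero_mul]

end HilbertTensor

theorem norm_sub_starProjection_le {E : Type*} [NormedAddCommGroup E] [InnerProductSpace ℂ E]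
    (L : Submodule ℂ E) [L.HasOrthogonalProjection] (x : E) {y : E} (hy : y ∈ L) :
    ‖x - L.starProjection x‖ ≤ ‖x - y‖ := by
  rw [L.starProjection_minimal x]
  exact ciInf_le ⟨0, by rintro _ ⟨w, rfl⟩; exact norm_nonneg _⟩ (⟨y, hy⟩ : L)

/-! ### Increasing families of subspaces along a tower -/

section Towers

variable {E : ℕ → Type*} [∀ n, NormedAddCommGroup (E n)] [∀ n, InnerProductSpace ℂ (E n)]
  {K : Type*} [NormedAddCommGroup K] [InnerProductSpace ℂ K]

/-- A point in the closure of the union of an increasing sequence of subspaces, each seen through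
an embedding `e n`, is approximated by elements of all late subspaces. -/
theorem eventually_exists_norm_sub_lt {s : (n : ℕ) → (E n →ₗᵢ[ℂ] E (n + 1))}
    {e : (n : ℕ) → (E n →ₗᵢ[ℂ] K)} {L : (n : ℕ) → Submodule ℂ (E n)}
    (hs : ∀ n, ∀ x ∈ L n, s n x ∈ L (n + 1)) (he : ∀ n x, e (n + 1) (s n x) = e n x)
    {y : K} (hy : y ∈ (⨆ n, (L n).map (e n).toLinearMap).topologicalClosure)
    {ε : ℝ} (hε : 0 < ε) : ∀ᶠ n in atTop, ∃ x ∈ L n, ‖y - e n x‖ < ε := by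
  have hmono : Monotone fun n => (L n).map (e n).toLinearMap := by
    refine monotone_nat_of_le_succ fun n => ?_
    rintro _ ⟨x, hx, rfl⟩
    exact ⟨s n x, hs n x hx, he n x⟩
  obtain ⟨z, hz, hyz⟩ := Metric.mem_closure_iff.1 hy ε hε
  obtain ⟨N, x, hx, rfl⟩ := (Submodule.mem_iSup_of_chain ⟨_, hmono⟩ z).1 hz
  refine eventually_atTop.2 ⟨N, fun n hn => ?_⟩
  obtain ⟨x', hx', h⟩ := hmono hn ⟨x, hx, rfl⟩
  refine ⟨x', hx', ?_⟩
  rw [← dist_eq_norm]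
  exact (congrArg (dist y) h).trans_lt hyz

variable {h P : Type u} [NormedAddCommGroup h] [InnerProductSpace ℂ h] [CompleteSpace h]
    [NormedAddCommGroup P] [InnerProductSpace ℂ P] (w : h →ₗᵢ[ℂ] HTensor h P)

/-- The iterates `h → h ⊗ P^{⊗ n}` of an isometry `w : h → h ⊗ P`, given by
`w₀ = 1` and `w_{n+1} = (w_n ⊗ 1) w`. -/
def towerIter : (n : ℕ) → (h →ₗᵢ[ℂ] (tower h P n).carrier)
  | 0 => LinearIsometry.id
  | n + 1 => (hmapIsometry (towerIter n) LinearIsometry.id).comp w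

theorem towerIter_succ_apply (n : ℕ) (ξ : h) :
    towerIter w (n + 1) ξ = hmapIsometry (towerIter w n) LinearIsometry.id (w ξ) := rfl

theorem hmapIsometry_hmapIsometry {E F G : Type*} [NormedAddCommGroup E] [InnerProductSpace ℂ E]
    [NormedAddCommGroup F] [InnerProductSpace ℂ F] [NormedAddCommGroup G] [InnerProductSpace ℂ G]
    {Q : Type*} [NormedAddCommGroup Q] [InnerProductSpace ℂ Q]
    {f : F →ₗᵢ[ℂ] G} {f' : E →ₗᵢ[ℂ] F} {g : E →ₗᵢ[ℂ] G} (hfg : ∀ x, f (f' x) = g x)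
    (z : HTensor E Q) : hmapIsometry f LinearIsometry.id
      (hmapIsometry f' (LinearIsometry.id : Q →ₗᵢ[ℂ] Q) z) =
        hmapIsometry g LinearIsometry.id z := by
  induction z using HTensor.induction with
  | hp => exact isClosed_eq (by fun_prop) (by fun_prop)
  | h0 => simp
  | htm x y => rw [hmapIsometry_htmul, hmapIsometry_htmul, hmapIsometry_htmul, hfg]; rfl
  | hadd z w hz hw => rw [map_add, map_add, map_add, hz, hw]

/-- The iterates can also be built from the inside: `w_{n+1} = (w ⊗ 1 ⊗ ⋯ ⊗ 1) w_n`. -/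
theorem towerStep_towerIter (n : ℕ) (ξ : h) :
    towerStep w n (towerIter w n ξ) = towerIter w (n + 1) ξ := by
  induction n generalizing ξ with
  | zero =>
    refine Eq.trans ?_ (towerIter_succ_apply w 0 ξ).symm
    change w ξ = hmapIsometry LinearIsometry.id LinearIsometry.id (w ξ)
    induction w ξ using HTensor.induction with
    | hp => exact isClosed_eq continuous_id (by fun_prop)
    | h0 => simp
    | htm x y => rw [hmapIsometry_htmul]; rfl
    | hadd z w hz hw => rw [map_add, ← hz, ← hw]
  | succ n ih => exact hmapIsometry_hmapIsometry ih (w ξ)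

end Towers

/-! ### Representations of spatial tensor products -/

/-- An intertwining relation `π (f a) y = U (σ a x)` on vectors passes to spatial tensor products. -/
theorem tensorRep_tensorMapId_apply {A B C E F G : Type u} [CStarAlgebra A] [CStarAlgebra B]
    [CStarAlgebra C] [NormedAddCommGroup E] [InnerProductSpace ℂ E] [CompleteSpace E]
    [NormedAddCommGroup F] [InnerProductSpace ℂ F] [CompleteSpace F]
    [NormedAddCommGroup G] [InnerProductSpace ℂ G] [CompleteSpace G]
    {σ : A →⋆ₙₐ[ℂ] (E →L[ℂ] E)} {π : B →⋆ₙₐ[ℂ] (G →L[ℂ] G)} {f : A →⋆ₙₐ[ℂ] B} {U : E →ₗᵢ[ℂ] G}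
    {x : E} {y : G} (hU : ∀ a, π (f a) y = U (σ a x)) (ρ : C →⋆ₙₐ[ℂ] (F →L[ℂ] F)) (q : F)
    (z : CTensor A C) : tensorRep π ρ (tensorMapId f z) (htmul y q) =
      hmapIsometry U LinearIsometry.id (tensorRep σ ρ z (htmul x q)) := by
  have hπ : Continuous (tensorRep π ρ) := CTensor.continuous_extend _
  have hσ : Continuous (tensorRep σ ρ) := CTensor.continuous_extend _
  have hf : Continuous (tensorMapId (C := C) f) := CTensor.continuous_extend _
  induction z using CTensor.induction with
  | hp =>
    exact isClosed_eq ((hπ.comp hf).clm_apply continuous_const)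
      ((LinearIsometry.continuous _).comp (hσ.clm_apply continuous_const))
  | h z =>
    induction z using AlgTensor.induction with
    | h0 => simp [CTensor.of_zero]
    | hadd x y hx hy => simp only [CTensor.of_add, map_add, add_apply, hx, hy]
    | htm a c =>
      rw [← ctmul, tensorMapId_ctmul, tensorRep_ctmul, tensorRep_ctmul, hmap_htmul, hmap_htmul,
        hmapIsometry_htmul, hU]
      rfl

namespace StationaryMarkovChain

variable {A C : Type u} [CStarAlgebra A] [PartialOrder A] [StarOrderedRing A]
  [CStarAlgebra C] [PartialOrder C] [StarOrderedRing C] (M : StationaryMarkovChain A C)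

/-! ### The random variables as vectors -/

theorem denseRange_vec : DenseRange M.vec := by
  have h : M.vec = fun a => ((M.φ.toPreGNS a : M.φ.PreGNS) : UniformSpace.Completion M.φ.PreGNS) :=
    funext M.vec_eq
  rw [h]
  exact UniformSpace.Completion.denseRange_coe.comp M.φ.toPreGNS.surjective.denseRange
    (UniformSpace.Completion.continuous_coe _)

/-- The isometries `v_n : 𝔥 → 𝔥 ⊗ P^{⊗ n}` generated by the associated isometry `v₁`. -/
abbrev v (n : ℕ) : M.h →ₗᵢ[ℂ] M.L2 n := towerIter M.v₁ n

/-- On vectors, the random variable `j_n` acts as the isometry `v_n`. -/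
theorem rvVec_eq (n : ℕ) (a : A) : M.rvVec n a = M.v n (M.vec a) := by
  induction n generalizing a with
  | zero => rfl
  | succ n ih =>
    rw [towerIter_succ_apply, v₁_vec]
    exact tensorRep_tensorMapId_apply ih M.ψ.gnsNonUnitalStarAlgHom M.Ωψ (M.j a)

/-! ### Noise and the distance from the noise -/

/-- On the noise, one step of the chain is one step of the free evolution, since
`v₁ Ω_φ = Ω_φ ⊗ Ω_ψ`. -/
theorem towerStep_of_mem_noise {n : ℕ} {x : M.L2 n} (hx : x ∈ M.noise n) :
    towerStep M.v₁ n x = towerStep M.freeStep n x := by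
  induction n with
  | zero =>
    obtain ⟨c, rfl⟩ := Submodule.mem_span_singleton.1 hx
    change M.v₁ (c • M.Ωφ) = M.freeStep (c • M.Ωφ)
    rw [map_smul, map_smul, v₁_Ωφ]
    rfl
  | succ n ih =>
    have hle : tensorSpan M.P (M.noise n) ≤
        LinearMap.eqLocus (towerStep M.v₁ (n + 1)).toLinearMap
          (towerStep M.freeStep (n + 1)).toLinearMap := by
      refine tensorSpan_le (isClosed_eq (LinearIsometry.continuous _)
        (LinearIsometry.continuous _)) fun x hx p => ?_
      exact (towerStep_htmul _ n x p).trans ((congrArg (fun y => htmul y p) (ih hx)).trans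
        (towerStep_htmul _ n x p).symm)
    exact hle hx

theorem towerStep_mem_noise {n : ℕ} {x : M.L2 n} (hx : x ∈ M.noise n) :
    towerStep M.v₁ n x ∈ M.noise (n + 1) := by
  induction n with
  | zero =>
    obtain ⟨c, rfl⟩ := Submodule.mem_span_singleton.1 hx
    change M.v₁ (c • M.Ωφ) ∈ tensorSpan M.P (ℂ ∙ M.Ωφ)
    rw [map_smul, v₁_Ωφ]
    exact Submodule.smul_mem _ _ (htmul_mem_tensorSpan (Submodule.mem_span_singleton_self _) _)
  | succ n ih =>
    have hle : tensorSpan M.P (M.noise n) ≤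
        (M.noise (n + 2)).comap (towerStep M.v₁ (n + 1)).toLinearMap := by
      refine tensorSpan_le ((M.isClosed_noise (n + 2)).preimage (LinearIsometry.continuous _))
        fun x hx p => ?_
      exact (congrArg (· ∈ M.noise (n + 2)) (towerStep_htmul M.v₁ n x p)).mpr
        (htmul_mem_tensorSpan (ih hx) p)
    exact hle hx

/-- The distance of `v_n ξ` from the noise. -/
def noiseDefect (ξ : M.h) (n : ℕ) : ℝ := ‖M.v n ξ - (M.noise n).starProjection (M.v n ξ)‖

theorem noiseDefect_le {ξ : M.h} {n : ℕ} {x : M.L2 n} (hx : x ∈ M.noise n) :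
    M.noiseDefect ξ n ≤ ‖M.v n ξ - x‖ :=
  norm_sub_starProjection_le _ _ hx

theorem noiseDefect_sq (ξ : M.h) (n : ℕ) :
    M.noiseDefect ξ n ^ 2 = ‖ξ‖ ^ 2 - ‖(M.noise n).starProjection (M.v n ξ)‖ ^ 2 := by
  have h := (M.noise n).norm_sq_eq_add_norm_sq_starProjection (M.v n ξ)
  rw [LinearIsometry.norm_map, Submodule.starProjection_orthogonal_val] at h
  rw [h, noiseDefect, add_sub_cancel_left]

/-- One step of the chain is isometric and maps noise to noise, so the distance cannot grow. -/
theorem antitone_noiseDefect (ξ : M.h) : Antitone (M.noiseDefect ξ) := by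
  refine antitone_nat_of_succ_le fun n => ?_
  refine (M.noiseDefect_le (M.towerStep_mem_noise
    ((M.noise n).starProjection_apply_mem (M.v n ξ)))).trans_eq ?_
  rw [← towerStep_towerIter, ← map_sub, LinearIsometry.norm_map]
  rfl

/-- By monotonicity, one good noise approximation of some `v_n ξ` for each `ε` suffices. -/
theorem tendsto_noiseDefect_of_approx {ξ : M.h}
    (hξ : ∀ ε > 0, ∃ n, ∃ x ∈ M.noise n, ‖M.v n ξ - x‖ < ε) :
    Tendsto (M.noiseDefect ξ) atTop (𝓝 0) := by
  rw [Metric.tendsto_atTop]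
  intro ε hε
  obtain ⟨n, x, hx, h⟩ := hξ ε hε
  refine ⟨n, fun m hm => ?_⟩
  rw [Real.dist_0_eq_abs, noiseDefect, abs_norm]
  exact ((M.antitone_noiseDefect ξ hm).trans (M.noiseDefect_le hx)).trans_lt h

theorem tendsto_noiseDefect_of_vec
    (hM : ∀ a, Tendsto (M.noiseDefect (M.vec a)) atTop (𝓝 0)) (ξ : M.h) :
    Tendsto (M.noiseDefect ξ) atTop (𝓝 0) := by
  refine M.tendsto_noiseDefect_of_approx fun ε hε => ?_
  obtain ⟨a, ha⟩ := M.denseRange_vec.exists_dist_lt ξ (half_pos hε)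
  obtain ⟨n, hn⟩ := ((hM a).eventually_lt_const (half_pos hε)).exists
  refine ⟨n, _, (M.noise n).starProjection_apply_mem (M.v n (M.vec a)), ?_⟩
  refine (norm_sub_le_norm_sub_add_norm_sub _ (M.v n (M.vec a)) _).trans_lt ?_
  rw [← map_sub, LinearIsometry.norm_map, ← dist_eq_norm]
  exact (add_lt_add ha hn).trans_eq (add_halves ε)

theorem tendsto_noiseDefect_iff (ξ : M.h) : Tendsto (M.noiseDefect ξ) atTop (𝓝 0) ↔
    Tendsto (fun n => ‖(M.noise n).starProjection (M.v n ξ)‖) atTop (𝓝 ‖ξ‖) := by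
  have h1 : Tendsto (M.noiseDefect ξ) atTop (𝓝 0) ↔
      Tendsto (fun n => M.noiseDefect ξ n ^ 2) atTop (𝓝 0) := by
    refine ⟨fun h => by simpa using h.pow 2, fun h => ?_⟩
    have := h.sqrt
    simp only [noiseDefect, Real.sqrt_sq (norm_nonneg _), Real.sqrt_zero] at this
    exact this
  rw [h1]
  simp_rw [noiseDefect_sq]
  constructor
  · intro h
    have := (tendsto_const_nhds (x := ‖ξ‖ ^ 2)).sub h
    simpa [Real.sqrt_sq (norm_nonneg _)] using this.sqrt
  · intro h
    have := (tendsto_const_nhds (x := ‖ξ‖ ^ 2)).sub (h.pow 2)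
    rwa [sub_self] at this

theorem noiseNormComplete_iff :
    M.NoiseNormComplete ↔ ∀ ξ, Tendsto (M.noiseDefect ξ) atTop (𝓝 0) := by
  have h : M.NoiseNormComplete ↔ ∀ a, Tendsto (M.noiseDefect (M.vec a)) atTop (𝓝 0) := by
    simp_rw [tendsto_noiseDefect_iff, NoiseNormComplete, rvVec_eq]
  exact h.trans ⟨M.tendsto_noiseDefect_of_vec, fun h a => h _⟩

/-! ### Scattering -/

theorem scattered_eq (n : ℕ) (a : A) :
    M.scattered n a = limitEmbed (towerStep M.freeStep) n (M.v n (M.vec a)) := by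
  rw [scattered, rvVec_eq]

/-- The noise part of `v_n ξ`, carried along by the free evolution, approximates all later
`v_k ξ` equally well, because the chain evolves freely on the noise. -/
theorem exists_mem_noise_norm_sub_eq (ξ : M.h) {n k : ℕ} (hk : n ≤ k) :
    ∃ x ∈ M.noise k, limitEmbed (towerStep M.freeStep) k x =
      limitEmbed (towerStep M.freeStep) n ((M.noise n).starProjection (M.v n ξ)) ∧
      ‖M.v k ξ - x‖ = M.noiseDefect ξ n := by
  induction k, hk using Nat.le_induction with
  | base => exact ⟨_, (M.noise n).starProjection_apply_mem (M.v n ξ), rfl, rfl⟩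
  | succ k hk ih =>
    obtain ⟨x, hx, he, hd⟩ := ih
    refine ⟨towerStep M.v₁ k x, M.towerStep_mem_noise hx, ?_, ?_⟩
    · rw [M.towerStep_of_mem_noise hx, ← he]
      exact limitEmbed_succ _ k x
    · rw [← towerStep_towerIter, ← map_sub, LinearIsometry.norm_map, hd]

theorem scatteringComplete_iff :
    M.ScatteringComplete ↔ ∀ ξ, Tendsto (M.noiseDefect ξ) atTop (𝓝 0) := by
  refine ⟨fun h => M.tendsto_noiseDefect_of_vec fun a => ?_, fun h a => ?_⟩
  · obtain ⟨y, hy, hlim⟩ := h a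
    refine M.tendsto_noiseDefect_of_approx fun ε hε => ?_
    have hnear := eventually_exists_norm_sub_lt
      (fun n x hx => M.towerStep_of_mem_noise hx ▸ M.towerStep_mem_noise hx)
      (limitEmbed_succ (towerStep M.freeStep)) hy (half_pos hε)
    obtain ⟨n, ⟨x, hx, hxy⟩, hn⟩ :=
      (hnear.and (Metric.tendsto_nhds.1 hlim _ (half_pos hε))).exists
    refine ⟨n, x, hx, ?_⟩
    rw [scattered_eq, dist_eq_norm] at hn
    rw [← LinearIsometry.norm_map (limitEmbed (towerStep M.freeStep) n), map_sub]
    exact ((norm_sub_le_norm_sub_add_norm_sub _ y _).trans_lt (add_lt_add hn hxy)).trans_eq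
      (add_halves ε)
  · have hdist : ∀ n k, n ≤ k → dist (M.scattered k a) (limitEmbed (towerStep M.freeStep) n
        ((M.noise n).starProjection (M.v n (M.vec a)))) = M.noiseDefect (M.vec a) n := by
      intro n k hk
      obtain ⟨x, -, he, hd⟩ := M.exists_mem_noise_norm_sub_eq (M.vec a) hk
      rw [← he, scattered_eq, dist_eq_norm]
      exact (congrArg norm (map_sub (limitEmbed (towerStep M.freeStep) k) _ _)).symm.trans
        ((LinearIsometry.norm_map _ _).trans hd)
    have hcauchy : CauchySeq fun n => M.scattered n a := by
      refine Metric.cauchySeq_iff'.2 fun ε hε => ?_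
      obtain ⟨N, hN⟩ := ((h (M.vec a)).eventually_lt_const (half_pos hε)).exists
      refine ⟨N, fun n hn => (dist_triangle_right _ _ (limitEmbed (towerStep M.freeStep) N
        ((M.noise N).starProjection (M.v N (M.vec a))))).trans_lt ?_⟩
      rw [hdist N n hn, hdist N N le_rfl]
      exact (add_lt_add hN hN).trans_eq (add_halves ε)
    obtain ⟨y, hy⟩ := cauchySeq_tendsto_of_complete hcauchy
    refine ⟨y, ?_, hy⟩
    -- `y` is the limit of the noise parts of the `S⁻ⁿ Tⁿ(a)` as well.
    refine (Submodule.isClosed_topologicalClosure _).mem_of_tendsto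
      (tendsto_of_tendsto_of_dist hy (h (M.vec a)|>.congr fun n => (hdist n n le_rfl).symm))
      (Eventually.of_forall fun n => ?_)
    exact Submodule.le_topologicalClosure _ (Submodule.mem_iSup_of_mem n
      ⟨_, (M.noise n).starProjection_apply_mem (M.v n (M.vec a)), rfl⟩)

end StationaryMarkovChain

/-! ### Word spans and observability -/

section WeakProcesses

variable {H P : Type*} [NormedAddCommGroup H] [InnerProductSpace ℂ H]
  [NormedAddCommGroup P] [InnerProductSpace ℂ P]

theorem wordOp_append (V : HTensor H P →ₗᵢ[ℂ] H) (α β : List P) :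
    wordOp V (α ++ β) = wordOp V α ∘L wordOp V β := by
  induction α with
  | nil => rfl
  | cons p α ih => rw [List.cons_append, wordOp, wordOp, ih, ContinuousLinearMap.comp_assoc]

theorem wordOp_mem_wordSpan (V : HTensor H P →ₗᵢ[ℂ] H) {L : Submodule ℂ H} {x : H} (hx : x ∈ L)
    (α : List P) : wordOp V α x ∈ wordSpan V L :=
  Submodule.le_topologicalClosure _ (Submodule.mem_iSup_of_mem α ⟨x, hx, rfl⟩)

theorem le_wordSpan (V : HTensor H P →ₗᵢ[ℂ] H) (L : Submodule ℂ H) : L ≤ wordSpan V L :=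
  fun _ hx => wordOp_mem_wordSpan V hx []

theorem wordSpan_le {V : HTensor H P →ₗᵢ[ℂ] H} {L K : Submodule ℂ H} (hK : IsClosed (K : Set H))
    (h : ∀ α, ∀ x ∈ L, wordOp V α x ∈ K) : wordSpan V L ≤ K := by
  refine Submodule.topologicalClosure_minimal _ (iSup_le fun α => ?_) hK
  rintro _ ⟨x, hx, rfl⟩
  exact h α x hx

theorem isClosed_wordSpan (V : HTensor H P →ₗᵢ[ℂ] H) (L : Submodule ℂ H) :
    IsClosed (wordSpan V L : Set H) :=
  Submodule.isClosed_topologicalClosure _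

theorem wordOp_mem_wordSpan_of_mem (V : HTensor H P →ₗᵢ[ℂ] H) {L : Submodule ℂ H} {x : H}
    (hx : x ∈ wordSpan V L) (α : List P) : wordOp V α x ∈ wordSpan V L := by
  suffices h : wordSpan V L ≤ (wordSpan V L).comap (wordOp V α).toLinearMap from h hx
  refine wordSpan_le ((isClosed_wordSpan V L).preimage (wordOp V α).continuous) fun β y hy => ?_
  change (wordOp V α ∘L wordOp V β) y ∈ wordSpan V L
  rw [← wordOp_append]
  exact wordOp_mem_wordSpan V hy _

namespace WeakProcess.Subprocess

variable [CompleteSpace H] {X : WeakProcess H P} (S : X.Subprocess)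

/-- By minimality of the process, `G = H` as soon as `G` contains the internal space. -/
theorem asymptoticallyComplete_iff : S.AsymptoticallyComplete ↔ X.internal ≤ S.space := by
  refine ⟨fun h => h.symm ▸ le_top, fun h => top_le_iff.1 ?_⟩
  rw [← X.minimal]
  exact wordSpan_le (isClosed_wordSpan _ _) fun α x hx => wordOp_mem_wordSpan_of_mem X.V (h hx) α

/-- A vector of `𝔨` that is not seen by the output space is orthogonal to all `V_α 𝔤`: the words
are lengthened one letter at a time on the right, and `V_p 𝔤` lies in the closed span of `𝔤` and
`E^𝔤`. -/
theorem inner_wordOp_eq_zero {ζ : H} (hζ : ζ ∈ S.internalᗮ)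
    (hobs : X.observabilityMap S.wandering ζ = 0) (α : List P) {x : H} (hx : x ∈ S.internal) :
    ⟪wordOp X.V α x, ζ⟫_ℂ = 0 := by
  induction α using List.reverseRecOn generalizing x with
  | nil => exact hζ x hx
  | append_singleton α p ih =>
    rw [wordOp_append]
    set y : H := wordOp X.V [p] x
    change ⟪wordOp X.V α y, ζ⟫_ℂ = 0
    set W : Submodule ℂ H :=
      (S.internal ⊔ ⨆ p : P, S.internal.map (rowOp X.V p).toLinearMap).topologicalClosure
    have hSW : S.internal ≤ W := le_sup_left.trans (Submodule.le_topologicalClosure _)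
    have hy : y ∈ W := Submodule.le_topologicalClosure _
      (Submodule.mem_sup_right (Submodule.mem_iSup_of_mem p ⟨x, hx, rfl⟩))
    have hout : y - S.internal.starProjection y ∈ S.wandering :=
      ⟨sub_mem hy (hSW (S.internal.starProjection_apply_mem y)),
        S.internal.sub_starProjection_mem_orthogonal y⟩
    have hE : (wordOp X.V α).adjoint ζ ∈ S.wanderingᗮ :=
      (S.wandering.starProjection_apply_eq_zero_iff).1 (congrFun hobs α)
    rw [← sub_add_cancel y (S.internal.starProjection y), map_add, inner_add_left,
      ih (S.internal.starProjection_apply_mem y), add_zero,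
      ← ContinuousLinearMap.adjoint_inner_right]
    exact hE _ hout

theorem AsymptoticallyComplete.quotientObservable {S : X.Subprocess}
    (hS : S.AsymptoticallyComplete) : S.QuotientObservable := by
  intro ξ hξ η hη h
  have hζ : ξ - η ∈ S.internalᗮ := sub_mem hξ.2 hη.2
  have hobs : X.observabilityMap S.wandering (ξ - η) = 0 := funext fun α => by
    have hα : S.wandering.starProjection ((wordOp X.V α).adjoint ξ) =
      S.wandering.starProjection ((wordOp X.V α).adjoint η) := congrFun h α
    simp only [WeakProcess.observabilityMap, map_sub, hα, sub_self, Pi.zero_apply]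
  have hle : S.space ≤ (ℂ ∙ (ξ - η))ᗮ :=
    wordSpan_le (Submodule.isClosed_orthogonal _) fun α x hx => by
      rw [Submodule.mem_orthogonal_singleton_iff_inner_left]
      exact S.inner_wordOp_eq_zero hζ hobs α hx
  have hmem : ξ - η ∈ S.space := by
    rw [show S.space = ⊤ from hS]
    exact Submodule.mem_top
  exact sub_eq_zero.1 (inner_self_eq_zero.1
    (Submodule.mem_orthogonal_singleton_iff_inner_left.1 (hle hmem)))

end WeakProcess.Subprocess

end WeakProcesses

/-! ### The associated weak process as a limit of the chain -/

section Unroll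

variable {H h P : Type u} [NormedAddCommGroup H] [InnerProductSpace ℂ H]
  [NormedAddCommGroup h] [InnerProductSpace ℂ h] [CompleteSpace h]
  [NormedAddCommGroup P] [InnerProductSpace ℂ P]

/-- The isometries `h ⊗ P^{⊗ n} → H`, `ξ ⊗ pₙ ⊗ ⋯ ⊗ p₁ ↦ V_{p₁} ⋯ V_{pₙ} ι ξ`. -/
def unroll (V : HTensor H P →ₗᵢ[ℂ] H) (ι : h →ₗᵢ[ℂ] H) :
    (n : ℕ) → ((tower h P n).carrier →ₗᵢ[ℂ] H)
  | 0 => ι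
  | n + 1 => V.comp (hmapIsometry (unroll V ι n) LinearIsometry.id)

theorem unroll_succ_htmul (V : HTensor H P →ₗᵢ[ℂ] H) (ι : h →ₗᵢ[ℂ] H) (n : ℕ)
    (x : (tower h P n).carrier) (p : P) :
    unroll V ι (n + 1) (htmul x p) = rowOp V p (unroll V ι n x) :=
  congrArg V (hmapIsometry_htmul _ _ x p)

end Unroll

namespace StationaryMarkovChain.IsAssociated

variable {A C : Type u} [CStarAlgebra A] [PartialOrder A] [StarOrderedRing A]
  [CStarAlgebra C] [PartialOrder C] [StarOrderedRing C] {M : StationaryMarkovChain A C}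
  {H : Type u} [NormedAddCommGroup H] [InnerProductSpace ℂ H] [CompleteSpace H]
  {X : WeakProcess H M.P} {ι : M.h →ₗᵢ[ℂ] H}


/-- `V V*` fixes `𝔥`, because `V*` is isometric there. -/
theorem V_hmapIsometry_v₁ (hX : M.IsAssociated X ι) (ξ : M.h) :
    X.V (hmapIsometry ι LinearIsometry.id (M.v₁ ξ)) = ι ξ := by
  rw [← sub_eq_zero, ← inner_self_eq_zero (𝕜 := ℂ), inner_sub_left, inner_sub_right,
    inner_sub_right, LinearIsometry.inner_map_map, LinearIsometry.inner_map_map,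
    LinearIsometry.inner_map_map, LinearIsometry.inner_map_map]
  have h1 : ∀ z η, ⟪X.V z, ι η⟫_ℂ = ⟪z, hmapIsometry ι LinearIsometry.id (M.v₁ η)⟫_ℂ := fun z η => by
    rw [← hX.adjoint_eq, ContinuousLinearMap.adjoint_inner_right]
    rfl
  rw [← inner_conj_symm (ι ξ), h1, LinearIsometry.inner_map_map, LinearIsometry.inner_map_map,
    inner_conj_symm]
  ring

theorem unroll_towerStep (hX : M.IsAssociated X ι) (n : ℕ) (x : M.L2 n) :
    unroll X.V ι (n + 1) (towerStep M.v₁ n x) = unroll X.V ι n x := by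
  induction n with
  | zero => exact hX.V_hmapIsometry_v₁ x
  | succ n ih => exact congrArg X.V (hmapIsometry_hmapIsometry ih x)

theorem unroll_v (hX : M.IsAssociated X ι) (n : ℕ) (ξ : M.h) : unroll X.V ι n (M.v n ξ) = ι ξ := by
  induction n with
  | zero => rfl
  | succ n ih => rw [← towerStep_towerIter, hX.unroll_towerStep, ih]

/-- The words of length `n` applied to `𝔤` span the image of the noise `Ω_φ ⊗ P^{⊗ n}`. -/
theorem space_eq (hX : M.IsAssociated X ι) : hX.subprocess.space =
    (⨆ n, (M.noise n).map (unroll X.V ι n).toLinearMap).topologicalClosure := by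
  apply le_antisymm
  · refine wordSpan_le (Submodule.isClosed_topologicalClosure _) fun α x hx => ?_
    refine Submodule.le_topologicalClosure _ (Submodule.mem_iSup_of_mem α.length ?_)
    induction α with
    | nil =>
      obtain ⟨c, rfl⟩ := Submodule.mem_span_singleton.1 hx
      exact ⟨c • M.Ωφ, Submodule.smul_mem _ _ (Submodule.mem_span_singleton_self _),
        map_smul ι c M.Ωφ⟩
    | cons p α ih =>
      obtain ⟨y, hy, hyx⟩ := ih
      refine ⟨htmul y p, htmul_mem_tensorSpan hy p, (unroll_succ_htmul X.V ι _ y p).trans ?_⟩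
      exact congrArg (rowOp X.V p) hyx
  · refine Submodule.topologicalClosure_minimal _ (iSup_le fun n => ?_) (isClosed_wordSpan _ _)
    rw [Submodule.map_le_iff_le_comap]
    induction n with
    | zero =>
      refine (Submodule.span_singleton_le_iff_mem _ _).2 (le_wordSpan _ _ ?_)
      exact Submodule.mem_span_singleton_self _
    | succ n ih =>
      refine tensorSpan_le
        (K := hX.subprocess.space.comap (unroll X.V ι (n + 1)).toLinearMap)
        ((isClosed_wordSpan _ _).preimage (LinearIsometry.continuous _)) fun x hx p => ?_
      exact ((congrArg (· ∈ hX.subprocess.space)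
        (unroll_succ_htmul X.V ι n x p)).mpr
        (wordOp_mem_wordSpan_of_mem X.V (ih hx) [p]))

theorem asymptoticallyComplete_iff (hX : M.IsAssociated X ι) : hX.subprocess.AsymptoticallyComplete ↔
    ∀ ξ, Tendsto (M.noiseDefect ξ) atTop (𝓝 0) := by
  rw [WeakProcess.Subprocess.asymptoticallyComplete_iff, ← hX.range_eq, hX.space_eq]
  constructor
  · refine fun h ξ => M.tendsto_noiseDefect_of_approx fun ε hε => ?_
    obtain ⟨n, x, hx, hn⟩ := (eventually_exists_norm_sub_lt (fun n x hx => M.towerStep_mem_noise hx)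
      hX.unroll_towerStep (h ⟨ξ, rfl⟩) hε).exists
    refine ⟨n, x, hx, ?_⟩
    rw [← LinearIsometry.norm_map (unroll X.V ι n), map_sub, hX.unroll_v]
    exact hn
  · rintro h _ ⟨ξ, rfl⟩
    refine (Submodule.isClosed_topologicalClosure _).mem_of_tendsto
      (f := fun n => unroll X.V ι n ((M.noise n).starProjection (M.v n ξ))) (b := atTop) ?_
      (Eventually.of_forall fun n => Submodule.le_topologicalClosure _ (Submodule.mem_iSup_of_mem n
        ⟨_, (M.noise n).starProjection_apply_mem (M.v n ξ), rfl⟩))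
    rw [tendsto_iff_dist_tendsto_zero]
    refine (h ξ).congr fun n => ?_
    rw [dist_comm, dist_eq_norm]
    change _ = ‖ι ξ - _‖
    rw [← hX.unroll_v n ξ, ← map_sub, LinearIsometry.norm_map]
    rfl

end StationaryMarkovChain.IsAssociated

/-! ### The transition operator -/

namespace StationaryMarkovChain

variable {A C : Type u} [CStarAlgebra A] [PartialOrder A] [StarOrderedRing A]
  [CStarAlgebra C] [PartialOrder C] [StarOrderedRing C] {M : StationaryMarkovChain A C}

variable (M) in
/-- The operator `v_n* Q_n v_n` on `𝔥`, where `Q_n` is the projection onto the noise. It is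
`Zⁿ(P_𝔤)` when `𝔥` is identified with the internal space. -/
def noiseOp (n : ℕ) : M.h →L[ℂ] M.h :=
  (M.v n).toContinuousLinearMap.adjoint ∘L (M.noise n).starProjection ∘L
    (M.v n).toContinuousLinearMap

theorem noiseOp_succ (n : ℕ) : M.noiseOp (n + 1) = M.v₁.toContinuousLinearMap.adjoint ∘L
    hmap (M.noiseOp n) (ContinuousLinearMap.id ℂ M.P) ∘L M.v₁.toContinuousLinearMap := by
  have : CompleteSpace (tensorSpan M.P (M.noise n)) :=
    (isClosed_tensorSpan M.P (M.noise n)).completeSpace_coe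
  have hQ : (M.noise (n + 1)).starProjection =
      hmap (M.noise n).starProjection (ContinuousLinearMap.id ℂ M.P) :=
    starProjection_tensorSpan (M.noise n)
  rw [noiseOp, hQ]
  exact adjoint_comp_hmap_comp M.v₁.toContinuousLinearMap (M.v n).toContinuousLinearMap _

theorem norm_noiseOp_sub_le (n : ℕ) (ξ : M.h) : ‖M.noiseOp n ξ - ξ‖ ≤ M.noiseDefect ξ n := by
  have h : (M.v n).toContinuousLinearMap.adjoint (M.v n ξ) = ξ :=
    ext_inner_left ℂ fun η => by
      rw [ContinuousLinearMap.adjoint_inner_right]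
      exact (M.v n).inner_map_map η ξ
  have h1 : M.noiseOp n ξ - ξ = (M.v n).toContinuousLinearMap.adjoint
      ((M.noise n).starProjection (M.v n ξ) - M.v n ξ) := by
    rw [map_sub, h]
    rfl
  rw [h1, noiseDefect, norm_sub_rev (M.v n ξ)]
  refine (ContinuousLinearMap.le_opNorm _ _).trans (mul_le_of_le_one_left (norm_nonneg _) ?_)
  rw [LinearIsometryEquiv.norm_map]
  exact (M.v n).norm_toContinuousLinearMap_le

theorem inner_noiseOp (n : ℕ) (η ξ : M.h) :
    ⟪η, M.noiseOp n ξ⟫_ℂ = ⟪M.v n η, (M.noise n).starProjection (M.v n ξ)⟫_ℂ :=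
  ContinuousLinearMap.adjoint_inner_right (M.v n).toContinuousLinearMap η
    ((M.noise n).starProjection (M.v n ξ))

theorem norm_inner_noiseOp_self (n : ℕ) (ξ : M.h) :
    ‖⟪ξ, M.noiseOp n ξ⟫_ℂ‖ = ‖(M.noise n).starProjection (M.v n ξ)‖ ^ 2 := by
  have hidem := Submodule.starProjection_eq_self_iff.2
    ((M.noise n).starProjection_apply_mem (M.v n ξ))
  rw [inner_noiseOp, ← hidem, ← Submodule.inner_starProjection_left_eq_right, hidem,
    inner_self_eq_norm_sq_to_K, norm_pow, RCLike.norm_ofReal, abs_norm]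

/-- Since `Q_n` is a projection, weak and strong convergence of `v_n* Q_n v_n` to `1` both amount
to the vectors `v_n ξ` approaching the noise. -/
theorem tendsto_noiseOp_iff (ξ : M.h) : Tendsto (fun n => M.noiseOp n ξ) atTop (𝓝 ξ) ↔
    Tendsto (M.noiseDefect ξ) atTop (𝓝 0) := by
  constructor
  · intro h
    rw [tendsto_noiseDefect_iff]
    have h1 := ((tendsto_const_nhds (x := ξ)).inner h (𝕜 := ℂ)).norm.sqrt
    simp_rw [norm_inner_noiseOp_self] at h1
    simpa [inner_self_eq_norm_sq_to_K, Real.sqrt_sq (norm_nonneg _)] using h1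
  · intro h
    rw [tendsto_iff_norm_sub_tendsto_zero]
    exact squeeze_zero (fun _ => norm_nonneg _) (fun n => norm_noiseOp_sub_le n ξ) h

namespace IsAssociated

variable {H : Type u} [NormedAddCommGroup H] [InnerProductSpace ℂ H] [CompleteSpace H]
  {X : WeakProcess H M.P} {ι : M.h →ₗᵢ[ℂ] H}

theorem mem_internal (hX : M.IsAssociated X ι) (ξ : M.h) : ι ξ ∈ X.internal :=
  hX.range_eq ▸ ⟨ξ, rfl⟩

theorem starProjection_V_hmapIsometry (hX : M.IsAssociated X ι) (z : HTensor M.h M.P) :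
    X.internal.starProjection (X.V (hmapIsometry ι LinearIsometry.id z)) =
      ι (M.v₁.toContinuousLinearMap.adjoint z) := by
  refine Submodule.eq_starProjection_of_mem_of_inner_eq_zero (hX.mem_internal _) fun y hy => ?_
  rw [← hX.range_eq] at hy
  obtain ⟨η, rfl⟩ := hy
  change ⟪_, ι η⟫_ℂ = 0
  rw [inner_sub_left, LinearIsometry.inner_map_map, ContinuousLinearMap.adjoint_inner_left,
    ← hX.V_hmapIsometry_v₁, LinearIsometry.inner_map_map, LinearIsometry.inner_map_map]
  exact sub_self _

/-- The transition operator is `x ↦ v₁* (x ⊗ 1) v₁` when `𝔥` is identified with the internal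
space. -/
theorem transition_apply (hX : M.IsAssociated X ι) {x : X.internal →L[ℂ] X.internal}
    {T : M.h →L[ℂ] M.h} (hx : ∀ ξ (hξ : ι ξ ∈ X.internal), (x ⟨ι ξ, hξ⟩ : H) = ι (T ξ)) (ξ : M.h)
    (hξ : ι ξ ∈ X.internal) : (X.transition x ⟨ι ξ, hξ⟩ : H) =
      ι (M.v₁.toContinuousLinearMap.adjoint
        (hmap T (ContinuousLinearMap.id ℂ M.P) (M.v₁ ξ))) := by
  have hT : ∀ z : HTensor M.h M.P,
      hmap (X.extendInternal x) (ContinuousLinearMap.id ℂ M.P)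
        (hmapIsometry ι LinearIsometry.id z) =
      hmapIsometry ι LinearIsometry.id (hmap T (ContinuousLinearMap.id ℂ M.P) z) := by
    intro z
    induction z using HTensor.induction with
    | hp => exact isClosed_eq (by fun_prop) (by fun_prop)
    | h0 => simp
    | hadd z w hz hw => rw [map_add, map_add, map_add, map_add, hz, hw]
    | htm η p =>
      have hη : X.extendInternal x (ι η) = ι (T η) := by
        rw [← hx η (hX.mem_internal η)]
        change ((x (X.internal.orthogonalProjectionOnto (ι η)) : X.internal) : H) = _
        rw [Submodule.orthogonalProjectionOnto_mem_subspace_eq_self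
          (⟨ι η, hX.mem_internal η⟩ : X.internal)]
      rw [hmapIsometry_htmul, hmap_htmul, hmap_htmul, hmapIsometry_htmul, hη]
      rfl
  change X.internal.starProjection (X.V (hmap (X.extendInternal x) (ContinuousLinearMap.id ℂ M.P)
    (X.V.toContinuousLinearMap.adjoint (ι ξ)))) = _
  rw [hX.adjoint_eq, hT, hX.starProjection_V_hmapIsometry]

theorem iterate_transition_apply (hX : M.IsAssociated X ι) (n : ℕ) (ξ : M.h)
    (hξ : ι ξ ∈ X.internal) :
    ((X.transition^[n] hX.subprocess.projection) ⟨ι ξ, hξ⟩ : H) = ι (M.noiseOp n ξ) := by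
  induction n generalizing ξ with
  | zero =>
    have h0 : M.noiseOp 0 ξ = (ℂ ∙ M.Ωφ).starProjection ξ :=
      ext_inner_left ℂ fun η => inner_noiseOp 0 η ξ
    have hproj : (ℂ ∙ ι M.Ωφ).starProjection (ι ξ) = ι ((ℂ ∙ M.Ωφ).starProjection ξ) := by
      have h1 := norm_cyclicVec M.φ M.φ_one
      rw [Submodule.starProjection_unit_singleton ℂ h1, Submodule.starProjection_unit_singleton ℂ
        ((LinearIsometry.norm_map ι _).trans h1), LinearIsometry.inner_map_map, map_smul]
    rw [h0, ← hproj]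
    change X.internal.starProjection ((ℂ ∙ ι M.Ωφ).starProjection (ι ξ)) = _
    rw [hproj]
    exact Submodule.starProjection_eq_self_iff.2 (hX.mem_internal _)
  | succ n ih =>
    rw [Function.iterate_succ_apply', hX.transition_apply ih, noiseOp_succ]
    rfl

theorem tendsto_iterate_transition_iff (hX : M.IsAssociated X ι) :
    (∀ ξ : X.internal, Tendsto (fun n : ℕ =>
      (X.transition^[n] hX.subprocess.projection) ξ) atTop (𝓝 ξ)) ↔
    ∀ ξ, Tendsto (M.noiseDefect ξ) atTop (𝓝 0) := by
  have key : ∀ ξ hξ, Tendsto (fun n : ℕ =>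
      (X.transition^[n] hX.subprocess.projection) ⟨ι ξ, hξ⟩) atTop (𝓝 ⟨ι ξ, hξ⟩) ↔
      Tendsto (M.noiseDefect ξ) atTop (𝓝 0) := by
    intro ξ hξ
    rw [← tendsto_noiseOp_iff, ι.isometry.isEmbedding.tendsto_nhds_iff,
      tendsto_subtype_rng]
    simp_rw [hX.iterate_transition_apply]
    rfl
  refine ⟨fun h ξ => (key ξ (hX.mem_internal ξ)).1 (h _), ?_⟩
  rintro h ⟨x, hx⟩
  obtain ⟨ξ, rfl⟩ : x ∈ LinearMap.range ι.toLinearMap := hX.range_eq.symm ▸ hx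
  exact (key ξ hx).2 (h ξ)

end IsAssociated

end StationaryMarkovChain

end

end WeakMarkov

theorem mainTheorem4 {A C : Type u} [CStarAlgebra A] [PartialOrder A] [StarOrderedRing A]
    [CStarAlgebra C] [PartialOrder C] [StarOrderedRing C] (M : StationaryMarkovChain A C)
    {H : Type u} [NormedAddCommGroup H] [InnerProductSpace ℂ H] [CompleteSpace H]
    (X : WeakProcess H M.P) (ι : M.h →ₗᵢ[ℂ] H) (hX : M.IsAssociated X ι) :
    List.TFAE [
      hX.subprocess.AsymptoticallyComplete,
      M.ScatteringComplete,
      M.NoiseNormComplete,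
      ∀ ξ : X.internal,
        Tendsto (fun n : ℕ => (X.transition^[n] hX.subprocess.projection) ξ) atTop (𝓝 ξ)] ∧
    (hX.subprocess.AsymptoticallyComplete → hX.subprocess.QuotientObservable) := by
  refine ⟨?_, WeakProcess.Subprocess.AsymptoticallyComplete.quotientObservable⟩
  rw [hX.asymptoticallyComplete_iff, M.scatteringComplete_iff, M.noiseNormComplete_iff,
    hX.tendsto_iterate_transition_iff]
  tfae_finish
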